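/- Let $\Bbbk$ be a commutative ring with unit and $n\ge 0$. Algebras are $\Bbbk$-algebras graded by parity in $\mathbb Z/2$; a dg algebra (dg module) carries an odd square-zero $\Bbbk$-linear map $d$ satisfying the super Leibniz rule. For an integer $m$ put $\{m\}=0$ if $m$ is even and $\{m\}=1$ if $m$ is odd. Let $\mathrm{OPol}_n=\Bbbk\langle x_1,\dots,x_n\rangle/(x_ix_j+x_jx_i,\ i\ne j)$ with all $x_i$ odd, and with the differential $d(x_i)=x_i^2$. Let $\theta$ and $w_0$ be the algebra automorphisms of $\mathrm{OPol}_n$ with $\theta(x_i)=(-1)^{i-1}x_i$ and $w_0(x_i)=x_{n+1-i}$, and let $\mathrm{O\Lambda}_n\subseteq\mathrm{OPol}_n$ be the subalgebra generated by $e_k=\sum_{i_1<\cdots<i_k}x_{i_1}\cdots x_{i_k}$, $k\ge 0$, with the restricted differential. Let $Z_n=\mathrm{OPol}_n\mathbf z$ be the free left $\mathrm{OPol}_n$-module on an even generator $\mathbf z$, with the right $\mathrm{O\Lambda}_n$-action determined by $\mathbf z f=(\theta\circ w_0)(f)\,\mathbf z$ and the differential determined by $d(\mathbf z)=\sum_{i=1}^n\{i-1\}x_i\mathbf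 z$. Let $\mathrm{END}_{\mathrm{O\Lambda}_n^{\mathrm{op}}}(Z_n)$ be the algebra of all right $\mathrm{O\Lambda}_n$-linear endomorphisms of $Z_n$, graded by parity, with $d(f)=d\circ f-(-1)^{p(f)}f\circ d$ for homogeneous $f$. Let $\mathrm{ONH}_n$ be the odd nilHecke algebra, generated by odd elements $x_1,\dots,x_n,\partial_1,\dots,\partial_{n-1}$ subject to $x_ix_j+x_jx_i=0$ ($i\neq j$), $\partial_i\partial_j+\partial_j\partial_i=0$ ($|i-j|>1$), $\partial_i^2=0$, $\partial_i\partial_{i+1}\partial_i=\partial_{i+1}\partial_i\partial_{i+1}$, $\partial_ix_j+x_j\partial_i=0$ ($j\ne i,i+1$), and $x_i\partial_i+\partial_ix_{i+1}=1=\partial_ix_i+x_{i+1}\partial_i$. Let $d$ be the super-derivation of $\mathrm{ONH}_n$ with $d(x_i)=x_i^2$ and $d(\partial_i)=1$. Then $Z_n$ is a dg $(\mathrm{OPol}_n,\mathrm{O\Lambda}_n)$-bimodule, $(\mathrm{ONH}_n,d)$ and $\mathrm{END}_{\mathrm{O\Lambda}_n^{\mathrm{op}}}(Z_n)$ are dg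 algebras, and there is an isomorphism of dg algebras $$(\mathrm{ONH}_n,d)\;\cong\;\mathrm{END}_{\mathrm{O\Lambda}_n^{\mathrm{op}}}(Z_n)$$ which sends $x_i$ to $f\mathbf z\mapsto x_if\,\mathbf z$ and $\partial_i$ to $f\mathbf z\mapsto\partial_i(f)\,\mathbf z$. Here $\partial_i$ acts on $\mathrm{OPol}_n$ as the odd divided difference operator: $\partial_i(x_j)=1$ if $j\in\{i,i+1\}$ and $0$ otherwise, and $\partial_i(fg)=\partial_i(f)g+(-1)^{p(f)}s_i(f)\partial_i(g)$ for homogeneous $f$, where $s_i$ interchanges $x_i$ and $x_{i+1}$. In particular the differential induced on $\mathrm{ONH}_n$ by this isomorphism is $d(x_i)=x_i^2$, $d(\partial_i)=1$. -/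

import Mathlib

noncomputable section

namespace OddNil

/-! ## Differential graded algebra, with parity as the grading -/

section DG

variable {k A B M : Type*} [CommRing k] [Ring A] [Algebra k A] [Ring B] [Algebra k B]
  [AddCommGroup M] [Module k M]

/-- The span of all words of length congruent to `p` modulo 2 in the letters `g i`.  This is the
parity grading of a superalgebra which is generated by the odd elements `g i`. -/
def wordPart (k : Type*) {A ι : Type*} [CommRing k] [Ring A] [Algebra k A] (g : ι → A)
    (p : ZMod 2) : Submodule k A :=
  Submodule.span k {a | ∃ l : List ι, (l.length : ZMod 2) = p ∧ (l.map g).prod = a}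

/-- A dg algebra: a `ℤ/2`-graded algebra with an odd square-zero super-derivation `d`. -/
structure IsDGAlgebra (gr : ZMod 2 → Submodule k A) (d : A →ₗ[k] A) : Prop where
  graded : SetLike.GradedMonoid gr
  internal : DirectSum.IsInternal gr
  odd : ∀ p, ∀ a ∈ gr p, d a ∈ gr (p + 1)
  sq_zero : ∀ a, d (d a) = 0
  leibniz : ∀ p, ∀ a ∈ gr p, ∀ b, d (a * b) = d a * b + (-1 : ℤˣ) ^ p • (a * d b)

/-- A dg `(A, B)`-bimodule.  Right `B`-modules are modules over `Bᵐᵒᵖ`, so that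
`m b = MulOpposite.op b • m`. -/
structure IsDGBimodule [Module A M] [Module Bᵐᵒᵖ M]
    (grA : ZMod 2 → Submodule k A) (dA : A →ₗ[k] A)
    (grB : ZMod 2 → Submodule k B) (dB : B →ₗ[k] B)
    (grM : ZMod 2 → Submodule k M) (d : M →ₗ[k] M) : Prop where
  left_dg : IsDGAlgebra grA dA
  right_dg : IsDGAlgebra grB dB
  commute : ∀ (a : A) (b : B) (m : M),
    a • (MulOpposite.op b • m) = MulOpposite.op b • (a • m)
  internal : DirectSum.IsInternal grM
  smul_mem : ∀ p q, ∀ a ∈ grA p, ∀ m ∈ grM q, a • m ∈ grM (p + q)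
  op_smul_mem : ∀ p q, ∀ m ∈ grM p, ∀ b ∈ grB q, MulOpposite.op b • m ∈ grM (p + q)
  odd : ∀ p, ∀ m ∈ grM p, d m ∈ grM (p + 1)
  sq_zero : ∀ m, d (d m) = 0
  left_leibniz : ∀ p, ∀ a ∈ grA p, ∀ m, d (a • m) = dA a • m + (-1 : ℤˣ) ^ p • (a • d m)
  right_leibniz : ∀ p, ∀ m ∈ grM p, ∀ b,
    d (MulOpposite.op b • m) =
      MulOpposite.op b • d m + (-1 : ℤˣ) ^ p • (MulOpposite.op (dB b) • m)

/-- An isomorphism of dg algebras: it respects parity and the differentials. -/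
structure IsDGAlgEquiv (grA : ZMod 2 → Submodule k A) (dA : A →ₗ[k] A)
    (grB : ZMod 2 → Submodule k B) (dB : B →ₗ[k] B) (e : A ≃ₐ[k] B) : Prop where
  map_parity : ∀ p a, e a ∈ grB p ↔ a ∈ grA p
  map_d : ∀ a, e (dA a) = dB (e a)

end DG

/-- `{m}`: zero for even `m`, one for odd `m`. -/
def bracket (m : ℕ) : ℕ := m % 2

/-! ## Skew polynomials -/

/-- The relations `x_i x_j + x_j x_i = 0` for `i ≠ j`. -/
inductive OPolRel (k : Type*) [CommRing k] (n : ℕ) :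
    FreeAlgebra k (Fin n) → FreeAlgebra k (Fin n) → Prop
  | anticomm (i j : Fin n) (h : i ≠ j) :
      OPolRel k n (FreeAlgebra.ι k i * FreeAlgebra.ι k j + FreeAlgebra.ι k j * FreeAlgebra.ι k i) 0

/-- The superalgebra of skew polynomials in `n` variables.  The variables `x_1, …, x_n` are indexed
by `Fin n`, so that `i : Fin n` stands for the variable with number `i + 1`. -/
def OPol (k : Type*) [CommRing k] (n : ℕ) : Type _ := RingQuot (OPolRel k n)

instance (k : Type*) [CommRing k] (n : ℕ) : Ring (OPol k n) :=
  inferInstanceAs (Ring (RingQuot (OPolRel k n)))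

instance (k : Type*) [CommRing k] (n : ℕ) : Algebra k (OPol k n) :=
  inferInstanceAs (Algebra k (RingQuot (OPolRel k n)))

namespace OPol

variable (k : Type*) [CommRing k] (n : ℕ)

/-- The quotient map. -/
def mk : FreeAlgebra k (Fin n) →ₐ[k] OPol k n := RingQuot.mkAlgHom k (OPolRel k n)

/-- The variables. -/
def x (i : Fin n) : OPol k n := mk k n (FreeAlgebra.ι k i)

/-- The parity grading: every variable is odd. -/
def part (p : ZMod 2) : Submodule k (OPol k n) := wordPart k (x k n) p

variable {k n}

theorem x_anticomm {i j : Fin n} (h : i ≠ j) : x k n i * x k n j + x k n j * x k n i = 0 := by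
  have h' : mk k n _ = mk k n _ := RingQuot.mkAlgHom_rel k (OPolRel.anticomm (k := k) i j h)
  simpa only [x, map_add, map_mul, map_zero] using h'

theorem x_mul_x {i j : Fin n} (h : i ≠ j) : x k n i * x k n j = -(x k n j * x k n i) :=
  eq_neg_of_add_eq_zero_left (x_anticomm h)

/-- The universal property of the skew polynomials. -/
def lift {A : Type*} [Ring A] [Algebra k A] (f : Fin n → A)
    (hf : ∀ i j, i ≠ j → f i * f j + f j * f i = 0) : OPol k n →ₐ[k] A :=
  RingQuot.liftAlgHom k ⟨FreeAlgebra.lift k f, by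
    rintro _ _ ⟨i, j, h⟩
    simpa using hf i j h⟩

@[simp] theorem lift_x {A : Type*} [Ring A] [Algebra k A] (f : Fin n → A)
    (hf : ∀ i j, i ≠ j → f i * f j + f j * f i = 0) (i : Fin n) :
    lift (k := k) f hf (x k n i) = f i := by
  have h := RingQuot.liftAlgHom_mkAlgHom_apply k (FreeAlgebra.lift k f) (s := OPolRel k n) (by
    rintro _ _ ⟨i, j, h⟩
    simpa using hf i j h) (FreeAlgebra.ι k i)
  exact h.trans (FreeAlgebra.lift_ι_apply _ _)

theorem algHom_ext {A : Type*} [Ring A] [Algebra k A] {f g : OPol k n →ₐ[k] A}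
    (h : ∀ i, f (x k n i) = g (x k n i)) : f = g := by
  apply RingQuot.ringQuot_ext'
  apply FreeAlgebra.hom_ext
  funext i
  exact h i

theorem induction {P : OPol k n → Prop} (hx : ∀ i, P (x k n i))
    (hc : ∀ r : k, P (algebraMap k (OPol k n) r)) (hadd : ∀ a b, P a → P b → P (a + b))
    (hmul : ∀ a b, P a → P b → P (a * b)) (a : OPol k n) : P a := by
  obtain ⟨a, rfl⟩ := RingQuot.mkAlgHom_surjective k (OPolRel k n) a
  induction a using FreeAlgebra.induction with
  | grade0 r => rw [AlgHom.commutes]; exact hc r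
  | grade1 i => exact hx i
  | mul a b ha hb => rw [map_mul]; exact hmul _ _ ha hb
  | add a b ha hb => rw [map_add]; exact hadd _ _ ha hb

/-- The algebra endomorphism `x_i ↦ c_i x_{w(i)}`. -/
def monomialMap (c : Fin n → k) (w : Equiv.Perm (Fin n)) : OPol k n →ₐ[k] OPol k n :=
  lift (fun i => c i • x k n (w i)) (by
    intro i j h
    have h' : w i ≠ w j := fun e => h (w.injective e)
    rw [smul_mul_smul_comm, smul_mul_smul_comm, mul_comm (c j), ← smul_add, x_anticomm h',
      smul_zero])

variable (k n)

/-- The parity involution. -/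
def parity : OPol k n →ₐ[k] OPol k n := monomialMap (fun _ => -1) (Equiv.refl _)

/-- The action of a permutation, `x_i ↦ x_{w(i)}`. -/
def perm (w : Equiv.Perm (Fin n)) : OPol k n →ₐ[k] OPol k n := monomialMap (fun _ => 1) w

/-- The action of the longest permutation, which reverses the order of the variables. -/
def w0 : OPol k n →ₐ[k] OPol k n := perm k n Fin.revPerm

/-- The twisting `θ`, which is `x_i ↦ (-1)^(i-1) x_i` when the variables are counted from `1`. -/
def theta : OPol k n →ₐ[k] OPol k n := monomialMap (fun i => (-1) ^ (i : ℕ)) (Equiv.refl _)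

/-- The composition `θ ∘ w_0`. -/
def thetaW0 : OPol k n →ₐ[k] OPol k n := (theta k n).comp (w0 k n)

variable {k n}

@[simp] theorem parity_x (i : Fin n) : parity k n (x k n i) = -x k n i := by
  simp [parity, monomialMap]

@[simp] theorem perm_x (w : Equiv.Perm (Fin n)) (i : Fin n) :
    perm k n w (x k n i) = x k n (w i) := by
  simp [perm, monomialMap]

@[simp] theorem theta_x (i : Fin n) : theta k n (x k n i) = (-1 : k) ^ (i : ℕ) • x k n i := by
  simp [theta, monomialMap]

theorem thetaW0_x (i : Fin n) :
    thetaW0 k n (x k n i) = (-1 : k) ^ (i.rev : ℕ) • x k n i.rev := by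
  simp [thetaW0, w0]

@[simp] theorem parity_parity (a : OPol k n) : parity k n (parity k n a) = a := by
  have : (parity k n).comp (parity k n) = AlgHom.id k _ := algHom_ext (by simp)
  exact DFunLike.congr_fun this a

theorem parity_of_mem {p : ZMod 2} {a : OPol k n} (ha : a ∈ part k n p) :
    parity k n a = (-1 : ℤˣ) ^ p • a := by
  induction ha using Submodule.span_induction with
  | mem a ha =>
    obtain ⟨l, rfl, rfl⟩ := ha
    induction l with
    | nil => simp
    | cons i l ih =>
      rw [List.map_cons, List.prod_cons, map_mul, ih, parity_x, List.length_cons, Nat.cast_succ,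
        uzpow_add, uzpow_one, mul_neg_one, neg_mul, mul_smul_comm]
      simp [Units.smul_def]
  | zero => simp
  | add a b _ _ ha hb => rw [map_add, ha, hb, smul_add]
  | smul r a _ ha => rw [map_smul, ha, smul_comm]

variable (k n) in
theorem iSup_part : ⨆ p, part k n p = ⊤ := by
  have hw : ∀ l : List (Fin n), (l.map (x k n)).prod ∈ ⨆ p, part k n p := fun l =>
    Submodule.mem_iSup_of_mem (l.length : ZMod 2) (Submodule.subset_span ⟨l, rfl, rfl⟩)
  have h : ∀ a : OPol k n, a ∈ Submodule.span k (Set.range fun l : List (Fin n) =>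
      (l.map (x k n)).prod) := by
    intro a
    induction a using OPol.induction with
    | hx i => exact Submodule.subset_span ⟨[i], by simp⟩
    | hc r =>
      rw [Algebra.algebraMap_eq_smul_one]
      exact Submodule.smul_mem _ _ (Submodule.subset_span ⟨[], by simp⟩)
    | hadd a b ha hb => exact add_mem ha hb
    | hmul a b ha hb =>
      have hab := Submodule.mul_mem_mul ha hb
      rw [Submodule.span_mul_span] at hab
      refine Submodule.span_mono ?_ hab
      rintro _ ⟨_, ⟨l, rfl⟩, _, ⟨l', rfl⟩, rfl⟩
      exact ⟨l ++ l', by simp⟩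
  rw [eq_top_iff]
  intro a _
  refine Submodule.span_le.2 ?_ (h a)
  rintro _ ⟨l, rfl⟩
  exact hw l

theorem thetaW0_parity (a : OPol k n) :
    thetaW0 k n (parity k n a) = parity k n (thetaW0 k n a) := by
  have : (thetaW0 k n).comp (parity k n) = (parity k n).comp (thetaW0 k n) :=
    algHom_ext (by simp [thetaW0_x])
  exact DFunLike.congr_fun this a

/-- For a map `f ↦ !![φ f, D f; 0, f]` into upper triangular matrices, being multiplicative means
`D (f g) = D f * g + φ f * D g`.  This is the homomorphism with `φ x_i = c_i` and `D x_i = v_i`. -/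
def triang (c v : Fin n → OPol k n)
    (h₁ : ∀ i j, i ≠ j → c i * c j + c j * c i = 0)
    (h₂ : ∀ i j, i ≠ j → (c i * v j + v i * x k n j) + (c j * v i + v j * x k n i) = 0) :
    OPol k n →ₐ[k] Matrix (Fin 2) (Fin 2) (OPol k n) :=
  lift (fun i => !![c i, v i; 0, x k n i]) (by
    intro i j h
    ext a b
    fin_cases a <;> fin_cases b <;>
      simp [h₁ i j h, h₂ i j h, x_anticomm h])

/-- The upper right entry of `triang`: the unique linear map `D` with `D x_i = v_i` and
`D (f g) = D f * g + φ f * D g`, where `φ` is the algebra map with `φ x_i = c_i`. -/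
def skewDer (c v : Fin n → OPol k n)
    (h₁ : ∀ i j, i ≠ j → c i * c j + c j * c i = 0)
    (h₂ : ∀ i j, i ≠ j → (c i * v j + v i * x k n j) + (c j * v i + v j * x k n i) = 0) :
    OPol k n →ₗ[k] OPol k n where
  toFun f := triang c v h₁ h₂ f 0 1
  map_add' f g := by simp
  map_smul' r f := by simp

theorem triang_eq (c v : Fin n → OPol k n)
    (h₁ : ∀ i j, i ≠ j → c i * c j + c j * c i = 0)
    (h₂ : ∀ i j, i ≠ j → (c i * v j + v i * x k n j) + (c j * v i + v j * x k n i) = 0)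
    (φ : OPol k n →ₐ[k] OPol k n) (hφ : ∀ i, φ (x k n i) = c i) (f : OPol k n) :
    triang c v h₁ h₂ f = !![φ f, skewDer c v h₁ h₂ f; 0, f] := by
  suffices h : triang c v h₁ h₂ f 0 0 = φ f ∧ triang c v h₁ h₂ f 1 0 = 0 ∧
      triang c v h₁ h₂ f 1 1 = f by
    obtain ⟨h00, h10, h11⟩ := h
    ext a b
    fin_cases a <;> fin_cases b <;> simp [h00, h10, h11, skewDer]
  induction f using OPol.induction with
  | hx i => simp [triang, hφ]
  | hc r => simp [Matrix.algebraMap_matrix_apply]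
  | hadd a b ha hb => simp [ha, hb]
  | hmul a b ha hb => simp [Matrix.mul_apply, Fin.sum_univ_two, ha, hb]

theorem skewDer_x (c v : Fin n → OPol k n) (h₁ h₂) (i : Fin n) :
    skewDer (k := k) c v h₁ h₂ (x k n i) = v i := by
  simp [skewDer, triang]

theorem skewDer_mul (c v : Fin n → OPol k n) (h₁ h₂)
    (φ : OPol k n →ₐ[k] OPol k n) (hφ : ∀ i, φ (x k n i) = c i) (f g : OPol k n) :
    skewDer (k := k) c v h₁ h₂ (f * g) =
      skewDer c v h₁ h₂ f * g + φ f * skewDer c v h₁ h₂ g := by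
  have h : skewDer (k := k) c v h₁ h₂ (f * g) =
      (triang c v h₁ h₂ f * triang c v h₁ h₂ g) 0 1 := by
    rw [← map_mul]; rfl
  rw [h, triang_eq c v h₁ h₂ φ hφ f, triang_eq c v h₁ h₂ φ hφ g]
  simp [Matrix.mul_apply, Fin.sum_univ_two, add_comm]

variable (k n)

/-- The differential on skew polynomials: the super-derivation with `d x_i = x_i ^ 2`. -/
def d : OPol k n →ₗ[k] OPol k n :=
  skewDer (fun i => -x k n i) (fun i => x k n i ^ 2)
    (fun i j h => by rw [neg_mul_neg, neg_mul_neg, x_anticomm h])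
    (fun i j h => by
      have e₁ : x k n i * x k n j ^ 2 = x k n j ^ 2 * x k n i := by
        rw [pow_two, ← mul_assoc, x_mul_x h, neg_mul, mul_assoc, x_mul_x h, mul_neg, neg_neg,
          mul_assoc]
      have e₂ : x k n j * x k n i ^ 2 = x k n i ^ 2 * x k n j := by
        rw [pow_two, ← mul_assoc, x_mul_x h.symm, neg_mul, mul_assoc, x_mul_x h.symm, mul_neg,
          neg_neg, mul_assoc]
      rw [neg_mul, neg_mul, e₁, e₂]; abel)

variable {k n}

theorem d_x (i : Fin n) : d k n (x k n i) = x k n i ^ 2 := skewDer_x ..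

theorem d_mul (f g : OPol k n) : d k n (f * g) = d k n f * g + parity k n f * d k n g :=
  skewDer_mul _ _ _ _ (parity k n) (by simp) f g

theorem d_algebraMap (r : k) : d k n (algebraMap k _ r) = 0 := by
  simp [d, skewDer, Matrix.algebraMap_matrix_apply]

theorem d_one : d k n 1 = 0 := by simpa using d_algebraMap (k := k) (n := n) 1

end OPol

/-- The left strand of the `i`-th neighbouring pair of strands. -/
def lo {n : ℕ} (i : Fin (n - 1)) : Fin n := ⟨i, by omega⟩

/-- The right strand of the `i`-th neighbouring pair of strands. -/
def hi {n : ℕ} (i : Fin (n - 1)) : Fin n := ⟨i + 1, by omega⟩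

theorem lo_ne_hi {n : ℕ} (i : Fin (n - 1)) : lo i ≠ hi i := by simp [lo, hi]

namespace OPol

variable (k : Type*) [CommRing k] (n : ℕ)

/-- The odd divided difference operator `∂_i` on skew polynomials: the linear map with
`∂_i x_j = 1` for `j = i, i+1` and `∂_i x_j = 0` otherwise, and
`∂_i (f g) = ∂_i f * g + (-1)^p(f) s_i(f) * ∂_i g`. -/
def divDiff (i : Fin (n - 1)) : OPol k n →ₗ[k] OPol k n :=
  skewDer (fun j => -x k n (Equiv.swap (lo i) (hi i) j)) (fun j => if j = lo i ∨ j = hi i then 1 else 0)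
    (fun j l h => by
      rw [neg_mul_neg, neg_mul_neg, x_anticomm (fun e => h ((Equiv.swap _ _).injective e))])
    (fun j l h => by
      have hne := lo_ne_hi i
      by_cases j1 : j = lo i
      · subst j1
        by_cases l1 : l = hi i
        · subst l1; simp
        · have l2 : l ≠ lo i := h.symm
          simp [l1, l2, Equiv.swap_apply_of_ne_of_ne l2 l1]
      · by_cases j2 : j = hi i
        · subst j2
          by_cases l1 : l = lo i
          · subst l1; simp
          · have l2 : l ≠ hi i := h.symm
            simp [l1, l2, Equiv.swap_apply_of_ne_of_ne l1 l2]
        · by_cases l3 : l = lo i ∨ l = hi i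
          · simp [j1, j2, l3, Equiv.swap_apply_of_ne_of_ne j1 j2]
          · simp [j1, j2, l3])

variable {k n}

theorem divDiff_x (i : Fin (n - 1)) (j : Fin n) :
    divDiff k n i (x k n j) = if j = lo i ∨ j = hi i then 1 else 0 := skewDer_x ..

theorem divDiff_mul (i : Fin (n - 1)) (f g : OPol k n) :
    divDiff k n i (f * g) = divDiff k n i f * g +
      parity k n (perm k n (Equiv.swap (lo i) (hi i)) f) * divDiff k n i g :=
  skewDer_mul _ _ _ _ ((parity k n).comp (perm k n (Equiv.swap (lo i) (hi i)))) (by simp) f g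

end OPol

/-! ## Odd symmetric polynomials -/

section OSym

variable (k : Type*) [CommRing k] (n : ℕ)

/-- The sum of the products `x_{i_1} ⋯ x_{i_m}` over all `i_1 < ⋯ < i_m` in `T`. -/
def esymmOn (T : Finset (Fin n)) (m : ℕ) : OPol k n :=
  ∑ s ∈ T.powersetCard m, ((s.sort (· ≤ ·)).map (OPol.x k n)).prod

/-- The (untwisted) odd elementary symmetric polynomial `e_m`. -/
def esymm (m : ℕ) : OPol k n := esymmOn k n Finset.univ m

/-- The algebra `OΛ_n` of (untwisted) odd symmetric polynomials. -/
def OSym : Subalgebra k (OPol k n) := Algebra.adjoin k (Set.range (esymm k n))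

variable {k n}

theorem esymmOn_zero (T : Finset (Fin n)) : esymmOn k n T 0 = 1 := by
  simp [esymmOn]

theorem esymmOn_empty (m : ℕ) : esymmOn k n ∅ (m + 1) = 0 := by
  rw [esymmOn, Finset.powersetCard_eq_empty.2 (by simp), Finset.sum_empty]

theorem esymmOn_insert (a : Fin n) (T : Finset (Fin n)) (h : ∀ b ∈ T, a < b) (m : ℕ) :
    esymmOn k n (insert a T) (m + 1) =
      esymmOn k n T (m + 1) + OPol.x k n a * esymmOn k n T m := by
  have ha : a ∉ T := fun h' => lt_irrefl _ (h a h')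
  unfold esymmOn
  rw [Finset.powersetCard_succ_insert ha, Finset.sum_union, Finset.sum_image, Finset.mul_sum]
  · congr 1
    refine Finset.sum_congr rfl fun s hs => ?_
    have hsT := (Finset.mem_powersetCard.1 hs).1
    rw [Finset.sort_insert (r := (· ≤ ·)) (fun b hb => (h b (hsT hb)).le) (fun h' => ha (hsT h'))]
    simp
  · intro s hs t ht e
    have hs' : a ∉ s := fun h' => ha ((Finset.mem_powersetCard.1 hs).1 h')
    have ht' : a ∉ t := fun h' => ha ((Finset.mem_powersetCard.1 ht).1 h')
    rw [← Finset.erase_insert hs', ← Finset.erase_insert ht', e]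
  · rw [Finset.disjoint_left]
    intro s hs hs'
    obtain ⟨t, -, rfl⟩ := Finset.mem_image.1 hs'
    exact ha ((Finset.mem_powersetCard.1 hs).1 (Finset.mem_insert_self a t))

theorem parity_esymmOn (T : Finset (Fin n)) (m : ℕ) :
    OPol.parity k n (esymmOn k n T m) = (-1 : k) ^ m • esymmOn k n T m := by
  induction T using Finset.induction_on_min generalizing m with
  | empty => cases m <;> simp [esymmOn_zero, esymmOn_empty]
  | insert a T h ih =>
    cases m with
    | zero => simp [esymmOn_zero]
    | succ m =>
      rw [esymmOn_insert a T h, map_add, map_mul, ih, ih, OPol.parity_x, pow_succ]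
      simp

theorem esymmOn_one_mul_x (T : Finset (Fin n)) (a : Fin n) (h : ∀ b ∈ T, a < b) :
    esymmOn k n T 1 * OPol.x k n a = -(OPol.x k n a * esymmOn k n T 1) := by
  induction T using Finset.induction_on_min with
  | empty => simp [esymmOn_empty]
  | insert b T hb ih =>
    have hab : b ≠ a := (h b (Finset.mem_insert_self _ _)).ne'
    rw [esymmOn_insert b T hb 0, esymmOn_zero, mul_one, add_mul, mul_add, OPol.x_mul_x hab,
      ih (fun c hc => h c (Finset.mem_insert_of_mem hc))]
    abel

theorem d_esymmOn (T : Finset (Fin n)) (m : ℕ) :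
    OPol.d k n (esymmOn k n T m) =
      esymmOn k n T 1 * esymmOn k n T m - bracket (m + 1) • esymmOn k n T (m + 1) := by
  induction T using Finset.induction_on_min generalizing m with
  | empty => cases m <;> simp [esymmOn_zero, esymmOn_empty, OPol.d_one]
  | insert a T h ih =>
    cases m with
    | zero => simp [esymmOn_zero, OPol.d_one, bracket]
    | succ m =>
      rw [esymmOn_insert a T h, esymmOn_insert a T h, esymmOn_insert a T h, map_add, OPol.d_mul,
        ih, ih, OPol.d_x, OPol.parity_x, esymmOn_zero, mul_one]
      have e := esymmOn_one_mul_x (k := k) T a h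
      have e' : esymmOn k n T 1 * (OPol.x k n a * esymmOn k n T m) =
          -(OPol.x k n a * (esymmOn k n T 1 * esymmOn k n T m)) := by
        rw [← mul_assoc, e, neg_mul, mul_assoc]
      rcases Nat.even_or_odd m with hm | hm
      · have h1 : bracket (m + 1) = 1 := by
          rw [bracket]; exact Nat.odd_iff.1 hm.add_one
        have h2 : bracket (m + 1 + 1) = 0 := by
          rw [bracket]; exact Nat.even_iff.1 hm.add_one.add_one
        rw [h1, h2]
        simp only [mul_add, add_mul, e', mul_sub, neg_mul, pow_two, mul_assoc, one_smul, zero_smul]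
        abel
      · have h1 : bracket (m + 1) = 0 := by
          rw [bracket]; exact Nat.even_iff.1 hm.add_one
        have h2 : bracket (m + 1 + 1) = 1 := by
          rw [bracket]; exact Nat.odd_iff.1 hm.add_one.add_one
        rw [h1, h2]
        simp only [mul_add, add_mul, e', mul_sub, neg_mul, pow_two, mul_assoc, one_smul, zero_smul,
          mul_zero]
        abel

theorem esymm_mem (m : ℕ) : esymm k n m ∈ OSym k n := Algebra.subset_adjoin ⟨m, rfl⟩

theorem parity_mem_OSym {a : OPol k n} (ha : a ∈ OSym k n) : OPol.parity k n a ∈ OSym k n := by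
  induction ha using Algebra.adjoin_induction with
  | mem a ha =>
    obtain ⟨m, rfl⟩ := ha
    rw [esymm, parity_esymmOn]
    exact Subalgebra.smul_mem _ (esymm_mem m) _
  | algebraMap r => rw [AlgHom.commutes]; exact Subalgebra.algebraMap_mem _ r
  | add a b _ _ ha hb => rw [map_add]; exact add_mem ha hb
  | mul a b _ _ ha hb => rw [map_mul]; exact mul_mem ha hb

theorem d_mem_OSym {a : OPol k n} (ha : a ∈ OSym k n) : OPol.d k n a ∈ OSym k n := by
  induction ha using Algebra.adjoin_induction with
  | mem a ha =>
    obtain ⟨m, rfl⟩ := ha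
    rw [esymm, d_esymmOn]
    exact sub_mem (mul_mem (esymm_mem 1) (esymm_mem m)) (nsmul_mem (esymm_mem (m + 1)) _)
  | algebraMap r => rw [OPol.d_algebraMap]; exact zero_mem _
  | add a b _ _ ha hb => rw [map_add]; exact add_mem ha hb
  | mul a b h₁ h₂ ha hb =>
    rw [OPol.d_mul]
    exact add_mem (mul_mem ha h₂) (mul_mem (parity_mem_OSym h₁) hb)

variable (k n)

/-- The parity grading of `OΛ_n`. -/
def OSym.part (p : ZMod 2) : Submodule k (OSym k n) :=
  (OPol.part k n p).comap (OSym k n).val.toLinearMap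

/-- The differential of `OΛ_n`, the restriction of that of the skew polynomials. -/
def OSym.d : OSym k n →ₗ[k] OSym k n :=
  (OPol.d k n).restrict (p := Subalgebra.toSubmodule (OSym k n))
    (q := Subalgebra.toSubmodule (OSym k n)) (fun _ h => d_mem_OSym h)

end OSym

/-! ## The bimodule `Z_n` -/

/-- The bimodule `Z_n = OPol_n z`, whose element `f z` is represented by `f`. -/
def ZBim (k : Type*) [CommRing k] (n : ℕ) : Type _ := OPol k n

namespace ZBim

variable (k : Type*) [CommRing k] (n : ℕ)

instance : AddCommGroup (ZBim k n) := inferInstanceAs (AddCommGroup (OPol k n))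

instance : Module k (ZBim k n) := inferInstanceAs (Module k (OPol k n))

/-- `Z_n` is free of rank one as a left module. -/
instance : Module (OPol k n) (ZBim k n) := inferInstanceAs (Module (OPol k n) (OPol k n))

/-- The right action of `OΛ_n`, by `(g z) f = g * (θ ∘ w_0)(f) z`. -/
instance : Module (OSym k n)ᵐᵒᵖ (ZBim k n) :=
  (Module.compHom (OPol k n) (RingHom.op ((OPol.thetaW0 k n).comp (OSym k n).val).toRingHom) :
    Module (OSym k n)ᵐᵒᵖ (OPol k n))

/-- The cyclic vector `z`. -/
def z : ZBim k n := (1 : OPol k n)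

/-- The identification of `f z` with `f`. -/
def coeff : ZBim k n ≃ₗ[OPol k n] OPol k n := LinearEquiv.refl _ _

variable {k n}

theorem coeff_smul_z (f : OPol k n) : coeff k n (f • z k n) = f := mul_one f

theorem coeff_op_smul (a : OSym k n) (m : ZBim k n) :
    coeff k n (MulOpposite.op a • m) = coeff k n m * OPol.thetaW0 k n a := rfl

theorem coeff_k_smul (r : k) (m : ZBim k n) : coeff k n (r • m) = r • coeff k n m := rfl

theorem op_smul_z (a : OSym k n) :
    MulOpposite.op a • z k n = OPol.thetaW0 k n a • z k n := by
  apply (coeff k n).injective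
  rw [coeff_op_smul, coeff_smul_z]
  exact one_mul _

instance : SMulCommClass (OSym k n)ᵐᵒᵖ k (ZBim k n) where
  smul_comm a r m := by
    apply (coeff k n).injective
    rw [← MulOpposite.op_unop a, coeff_op_smul, coeff_k_smul, coeff_k_smul, coeff_op_smul,
      smul_mul_assoc]

instance : IsScalarTower k (OSym k n)ᵐᵒᵖ (ZBim k n) where
  smul_assoc r a m := by
    apply (coeff k n).injective
    rw [← MulOpposite.op_unop a, ← MulOpposite.op_smul, coeff_op_smul, coeff_k_smul, coeff_op_smul]
    simp

variable (k n)

/-- `coeff` as a `k`-linear map. -/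
def coeffK : ZBim k n ≃ₗ[k] OPol k n := LinearEquiv.refl _ _

/-- The parity grading of `Z_n`: the cyclic vector is even. -/
def part (p : ZMod 2) : Submodule k (ZBim k n) :=
  (OPol.part k n p).comap (coeffK k n).toLinearMap

/-- The element `∑ {i-1} x_i`; the sum runs over the variables, counted from `1`. -/
def dz : OPol k n := ∑ i : Fin n, bracket (i : ℕ) • OPol.x k n i

/-- The differential of `Z_n`, with `d z = ∑ {i-1} x_i z` and
`d (f z) = d f z + (-1)^p(f) f d z`. -/
def d : ZBim k n →ₗ[k] ZBim k n where
  toFun m := (OPol.d k n (coeff k n m) + OPol.parity k n (coeff k n m) * dz k n) • z k n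
  map_add' a b := by simp only [map_add, add_mul, add_smul]; abel
  map_smul' r a := by
    apply (coeff k n).injective
    rw [RingHom.id_apply, coeff_k_smul, coeff_k_smul, coeff_smul_z, coeff_smul_z, map_smul, map_smul,
      smul_mul_assoc, smul_add]

/-- The parity involution of `Z_n`. -/
def parity : ZBim k n →ₗ[k] ZBim k n where
  toFun m := OPol.parity k n (coeff k n m) • z k n
  map_add' a b := by simp only [map_add, add_smul]
  map_smul' r a := by
    apply (coeff k n).injective
    rw [RingHom.id_apply, coeff_k_smul, coeff_k_smul, coeff_smul_z, coeff_smul_z, map_smul]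

variable {k n}

theorem coeff_d (m : ZBim k n) : coeff k n (d k n m) =
    OPol.d k n (coeff k n m) + OPol.parity k n (coeff k n m) * dz k n := coeff_smul_z _

theorem coeff_parity (m : ZBim k n) :
    coeff k n (parity k n m) = OPol.parity k n (coeff k n m) := coeff_smul_z _

theorem d_z : d k n (z k n) = ∑ i : Fin n, bracket (i : ℕ) • (OPol.x k n i • z k n) := by
  apply (coeff k n).injective
  have h : coeff k n (z k n) = 1 := rfl
  rw [coeff_d, h, OPol.d_one, map_one, zero_add, one_mul, map_sum, dz]
  exact Finset.sum_congr rfl fun i _ => by rw [map_nsmul, coeff_smul_z]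

theorem x_dz (i : Fin n) : OPol.x k n i * dz k n + dz k n * OPol.x k n i =
    (2 * bracket (i : ℕ)) • OPol.x k n i ^ 2 := by
  rw [dz, Finset.mul_sum, Finset.sum_mul, ← Finset.sum_add_distrib, Finset.sum_eq_single i]
  · rw [mul_smul_comm, smul_mul_assoc, pow_two, ← smul_add, ← two_nsmul, smul_smul, mul_comm]
  · intro j _ h
    rw [mul_smul_comm, smul_mul_assoc, ← smul_add, OPol.x_anticomm h.symm, smul_zero]
  · simp

theorem d_thetaW0 (a : OPol k n) :
    OPol.d k n (OPol.thetaW0 k n a) + OPol.parity k n (OPol.thetaW0 k n a) * dz k n =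
      dz k n * OPol.thetaW0 k n a + OPol.thetaW0 k n (OPol.d k n a) := by
  induction a using OPol.induction with
  | hx i =>
    rw [OPol.d_x, map_pow, OPol.thetaW0_x, map_smul, map_smul, OPol.d_x, OPol.parity_x]
    have h := x_dz (k := k) i.rev
    rw [add_comm, ← eq_sub_iff_add_eq] at h
    rw [smul_pow, ← pow_mul, mul_smul_comm, h, smul_mul_assoc]
    rcases Nat.even_or_odd (i.rev : ℕ) with hi | hi
    · have hb : bracket (i.rev : ℕ) = 0 := Nat.even_iff.1 hi
      rw [hb, hi.neg_one_pow, (hi.mul_right 2).neg_one_pow]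
      simp
      abel
    · have hb : bracket (i.rev : ℕ) = 1 := Nat.odd_iff.1 hi
      rw [hb, hi.neg_one_pow, (even_two.mul_left _).neg_one_pow]
      simp [two_smul]
      abel
  | hc r =>
    simp only [AlgHom.commutes, OPol.d_algebraMap, map_zero, zero_add, add_zero]
    exact Algebra.commutes r _
  | hadd a b ha hb =>
    simp only [map_add, add_mul, mul_add]
    rw [add_add_add_comm, ha, hb, add_add_add_comm]
  | hmul a b ha hb =>
    simp only [map_mul, OPol.d_mul, map_add]
    have ha' := congrArg (· * OPol.thetaW0 k n b) ha
    have hb' := congrArg (OPol.parity k n (OPol.thetaW0 k n a) * ·) hb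
    simp only [add_mul, mul_add] at ha' hb'
    rw [OPol.thetaW0_parity]
    simp only [← mul_assoc] at ha' hb' ⊢
    rw [add_assoc, hb', ← add_assoc, ha', add_assoc]

theorem d_op_smul (a : OSym k n) (m : ZBim k n) :
    d k n (MulOpposite.op a • m) =
      MulOpposite.op a • d k n m + MulOpposite.op (OSym.d k n a) • parity k n m := by
  apply (coeff k n).injective
  have h : ((OSym.d k n a : OSym k n) : OPol k n) = OPol.d k n a := rfl
  rw [map_add, coeff_d, coeff_op_smul, coeff_op_smul, coeff_op_smul, coeff_d, coeff_parity, h,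
    OPol.d_mul, map_mul, add_assoc, mul_assoc, ← mul_add, d_thetaW0, mul_add, add_mul, mul_assoc,
    add_assoc]

theorem parity_op_smul (a : OSym k n) (m : ZBim k n) :
    parity k n (MulOpposite.op a • m) =
      MulOpposite.op (⟨_, parity_mem_OSym a.2⟩ : OSym k n) • parity k n m := by
  apply (coeff k n).injective
  rw [coeff_parity, coeff_op_smul, coeff_op_smul, coeff_parity, map_mul, OPol.thetaW0_parity]

theorem parity_parity (m : ZBim k n) : parity k n (parity k n m) = m := by
  apply (coeff k n).injective
  rw [coeff_parity, coeff_parity, OPol.parity_parity]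

theorem parity_of_mem {p : ZMod 2} {m : ZBim k n} (hm : m ∈ part k n p) :
    parity k n m = (-1 : ℤˣ) ^ p • m := by
  apply (coeff k n).injective
  rw [coeff_parity]
  have hm' : coeff k n m ∈ OPol.part k n p := hm
  exact OPol.parity_of_mem hm'

theorem iSup_part : ⨆ p, part k n p = ⊤ := OPol.iSup_part k n

end ZBim

/-! ## The endomorphism dg algebra of `Z_n` as a right `OΛ_n`-module -/

section END

variable (k : Type*) [CommRing k] (n : ℕ)

/-- The algebra of all right `OΛ_n`-linear endomorphisms of `Z_n`. -/
abbrev EndZ : Type _ := Module.End (OSym k n)ᵐᵒᵖ (ZBim k n)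

namespace EndZ

/-- The endomorphisms of parity `p`. -/
def part (p : ZMod 2) : Submodule k (EndZ k n) where
  carrier := {f | ∀ q, ∀ m ∈ ZBim.part k n q, f m ∈ ZBim.part k n (q + p)}
  add_mem' hf hg q m hm := add_mem (hf q m hm) (hg q m hm)
  zero_mem' _ _ _ := zero_mem _
  smul_mem' r _ hf q m hm := Submodule.smul_mem _ r (hf q m hm)

/-- Conjugation by the parity involution, `f ↦ ι f ι`; this is `f ↦ (-1)^p(f) f`. -/
def conj : EndZ k n →ₗ[k] EndZ k n where
  toFun f :=
    { toFun := fun m => ZBim.parity k n (f (ZBim.parity k n m))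
      map_add' := fun a b => by simp
      map_smul' := fun a m => by
        obtain ⟨a, rfl⟩ := MulOpposite.op_surjective a
        rw [ZBim.parity_op_smul, map_smul, ZBim.parity_op_smul]
        simp }
  map_add' f g := by ext m; simp
  map_smul' r f := by ext m; simp

/-- The differential `d(f) = d ∘ f - (-1)^p(f) f ∘ d`. -/
def d : EndZ k n →ₗ[k] EndZ k n where
  toFun f :=
    { toFun := fun m => ZBim.d k n (f m) - conj k n f (ZBim.d k n m)
      map_add' := fun a b => by simp only [map_add]; abel
      map_smul' := fun a m => by
        obtain ⟨a, rfl⟩ := MulOpposite.op_surjective a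
        have h : conj k n f (ZBim.parity k n m) = ZBim.parity k n (f m) := by
          simp [conj, ZBim.parity_parity]
        simp only [map_smul, ZBim.d_op_smul, map_add, h, smul_sub, RingHom.id_apply]
        abel }
  map_add' f g := by ext m; simp; abel
  map_smul' r f := by ext m; simp [smul_sub]

variable {k n}

theorem conj_apply (f : EndZ k n) (m : ZBim k n) :
    conj k n f m = ZBim.parity k n (f (ZBim.parity k n m)) := rfl

theorem d_apply (f : EndZ k n) (m : ZBim k n) :
    d k n f m = ZBim.d k n (f m) - conj k n f (ZBim.d k n m) := rfl

theorem conj_of_mem {p : ZMod 2} {f : EndZ k n} (hf : f ∈ part k n p) :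
    conj k n f = (-1 : ℤˣ) ^ p • f := by
  ext m
  have hm : m ∈ ⨆ q, ZBim.part k n q := by
    rw [ZBim.iSup_part]; trivial
  rw [LinearMap.smul_apply, conj_apply]
  induction hm using Submodule.iSup_induction' with
  | mem q m hm =>
    rw [ZBim.parity_of_mem hm, Units.smul_def, map_zsmul, map_zsmul,
      ZBim.parity_of_mem (hf q m hm), ← Units.smul_def, smul_smul, uzpow_add, ← mul_assoc,
      ← uzpow_add, CharTwo.add_self_eq_zero, uzpow_zero, one_mul]
  | zero => simp
  | add a b _ _ ha hb => rw [map_add, map_add, map_add, ha, hb, map_add, smul_add]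

/-- The differential on homogeneous endomorphisms. -/
theorem d_of_mem {p : ZMod 2} {f : EndZ k n} (hf : f ∈ part k n p) (m : ZBim k n) :
    d k n f m = ZBim.d k n (f m) - (-1 : ℤˣ) ^ p • f (ZBim.d k n m) := by
  rw [d_apply, conj_of_mem hf]; rfl

end EndZ

end END

/-! ## The odd nilHecke algebra -/

/-- The generators: dots `x_1, …, x_n` and crossings `∂_1, …, ∂_{n-1}`. -/
inductive ONHGen (n : ℕ) : Type
  | dot (i : Fin n) : ONHGen n
  | cross (i : Fin (n - 1)) : ONHGen n

/-- A dot in the free algebra on the generators. -/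
abbrev preX (k : Type*) [CommRing k] {n : ℕ} (i : Fin n) : FreeAlgebra k (ONHGen n) :=
  FreeAlgebra.ι k (ONHGen.dot i)

/-- A crossing in the free algebra on the generators. -/
abbrev preD (k : Type*) [CommRing k] {n : ℕ} (i : Fin (n - 1)) : FreeAlgebra k (ONHGen n) :=
  FreeAlgebra.ι k (ONHGen.cross i)

/-- The defining relations of the odd nilHecke algebra. -/
inductive ONHRel (k : Type*) [CommRing k] (n : ℕ) :
    FreeAlgebra k (ONHGen n) → FreeAlgebra k (ONHGen n) → Prop
  | dot_dot (i j : Fin n) (h : i ≠ j) :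
      ONHRel k n (preX k i * preX k j + preX k j * preX k i) 0
  | cross_cross (i j : Fin (n - 1)) (h : (i : ℕ) + 1 < j ∨ (j : ℕ) + 1 < i) :
      ONHRel k n (preD k i * preD k j + preD k j * preD k i) 0
  | cross_sq (i : Fin (n - 1)) : ONHRel k n (preD k i * preD k i) 0
  | braid (i j : Fin (n - 1)) (h : (j : ℕ) = i + 1) :
      ONHRel k n (preD k i * preD k j * preD k i) (preD k j * preD k i * preD k j)
  | cross_dot (i : Fin (n - 1)) (j : Fin n) (h₁ : j ≠ lo i) (h₂ : j ≠ hi i) :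
      ONHRel k n (preD k i * preX k j + preX k j * preD k i) 0
  | slide_left (i : Fin (n - 1)) :
      ONHRel k n (preX k (lo i) * preD k i + preD k i * preX k (hi i)) 1
  | slide_right (i : Fin (n - 1)) :
      ONHRel k n (preD k i * preX k (lo i) + preX k (hi i) * preD k i) 1

/-- The odd nilHecke algebra on `n` strands. -/
def ONH (k : Type*) [CommRing k] (n : ℕ) : Type _ := RingQuot (ONHRel k n)

instance (k : Type*) [CommRing k] (n : ℕ) : Ring (ONH k n) :=
  inferInstanceAs (Ring (RingQuot (ONHRel k n)))

instance (k : Type*) [CommRing k] (n : ℕ) : Algebra k (ONH k n) :=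
  inferInstanceAs (Algebra k (RingQuot (ONHRel k n)))

namespace ONH

variable (k : Type*) [CommRing k] (n : ℕ)

/-- The quotient map. -/
def mk : FreeAlgebra k (ONHGen n) →ₐ[k] ONH k n := RingQuot.mkAlgHom k (ONHRel k n)

/-- The generators of the odd nilHecke algebra. -/
def gen (g : ONHGen n) : ONH k n := mk k n (FreeAlgebra.ι k g)

/-- The dot on the `i`-th strand. -/
def x (i : Fin n) : ONH k n := gen k n (ONHGen.dot i)

/-- The crossing of the `i`-th and the next strand. -/
def del (i : Fin (n - 1)) : ONH k n := gen k n (ONHGen.cross i)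

/-- The parity grading: dots and crossings are odd. -/
def part (p : ZMod 2) : Submodule k (ONH k n) := wordPart k (gen k n) p

variable {k n}

theorem rel {a b : FreeAlgebra k (ONHGen n)} (h : ONHRel k n a b) :
    mk k n a = mk k n b :=
  RingQuot.mkAlgHom_rel k h

theorem dot_dot {i j : Fin n} (h : i ≠ j) : x k n i * x k n j + x k n j * x k n i = 0 := by
  simpa only [x, del, gen, map_add, map_mul, map_zero] using rel (ONHRel.dot_dot (k := k) i j h)

theorem cross_cross {i j : Fin (n - 1)} (h : (i : ℕ) + 1 < j ∨ (j : ℕ) + 1 < i) :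
    del k n i * del k n j + del k n j * del k n i = 0 := by
  simpa only [x, del, gen, map_add, map_mul, map_zero] using rel (ONHRel.cross_cross (k := k) i j h)

theorem cross_sq (i : Fin (n - 1)) : del k n i * del k n i = 0 := by
  simpa only [x, del, gen, map_mul, map_zero] using rel (ONHRel.cross_sq (k := k) i)

theorem braid {i j : Fin (n - 1)} (h : (j : ℕ) = i + 1) :
    del k n i * del k n j * del k n i = del k n j * del k n i * del k n j := by
  simpa only [x, del, gen, map_mul] using rel (ONHRel.braid (k := k) i j h)

theorem cross_dot {i : Fin (n - 1)} {j : Fin n} (h₁ : j ≠ lo i) (h₂ : j ≠ hi i) :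
    del k n i * x k n j + x k n j * del k n i = 0 := by
  simpa only [x, del, gen, map_add, map_mul, map_zero] using rel (ONHRel.cross_dot (k := k) i j h₁ h₂)

theorem slide_left (i : Fin (n - 1)) :
    x k n (lo i) * del k n i + del k n i * x k n (hi i) = 1 := by
  simpa only [x, del, gen, map_add, map_mul, map_one] using rel (ONHRel.slide_left (k := k) i)

theorem slide_right (i : Fin (n - 1)) :
    del k n i * x k n (lo i) + x k n (hi i) * del k n i = 1 := by
  simpa only [x, del, gen, map_add, map_mul, map_one] using rel (ONHRel.slide_right (k := k) i)

/-- The values of the differential on the generators: `d x_i = x_i ^ 2` and `d ∂_i = 1`. -/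
def dGen : ONHGen n → ONH k n
  | ONHGen.dot i => x k n i ^ 2
  | ONHGen.cross _ => 1

variable (k n)

/-- The homomorphism `a ↦ !![ι a, d a; 0, a]`, where `ι` is the parity involution. -/
def triang : ONH k n →ₐ[k] Matrix (Fin 2) (Fin 2) (ONH k n) :=
  RingQuot.liftAlgHom k ⟨FreeAlgebra.lift k fun g => !![-gen k n g, dGen g; 0, gen k n g], by
    have sq_comm : ∀ a b : ONH k n, a * b + b * a = 0 → a * b ^ 2 = b ^ 2 * a := by
      intro a b h
      have h' := eq_neg_of_add_eq_zero_left h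
      rw [pow_two, ← mul_assoc, h', neg_mul, mul_assoc, h', mul_neg, neg_neg, mul_assoc]
    have key : ∀ a b v w : ONH k n,
        (!![-a, v; 0, a] * !![-b, w; 0, b] : Matrix (Fin 2) (Fin 2) (ONH k n)) =
          !![a * b, -(a * w) + v * b; 0, a * b] := by
      intro a b v w
      ext i j
      fin_cases i <;> fin_cases j <;> simp [Matrix.mul_apply, Fin.sum_univ_two]
    have key' : ∀ a b v w : ONH k n,
        (!![a, v; 0, a] * !![-b, w; 0, b] : Matrix (Fin 2) (Fin 2) (ONH k n)) =
          !![-(a * b), a * w + v * b; 0, a * b] := by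
      intro a b v w
      ext i j
      fin_cases i <;> fin_cases j <;> simp [Matrix.mul_apply, Fin.sum_univ_two]
    have mat : ∀ a b c e a' b' c' e' : ONH k n, a = a' → b = b' → c = c' → e = e' →
        (!![a, b; c, e] : Matrix (Fin 2) (Fin 2) (ONH k n)) = !![a', b'; c', e'] := by
      rintro a b c e _ _ _ _ rfl rfl rfl rfl; rfl
    have addm : ∀ a b c e a' b' c' e' : ONH k n,
        (!![a, b; c, e] + !![a', b'; c', e'] : Matrix (Fin 2) (Fin 2) (ONH k n)) =
          !![a + a', b + b'; c + c', e + e'] := by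
      intros
      ext i j
      fin_cases i <;> fin_cases j <;> simp
    have zerom : (0 : Matrix (Fin 2) (Fin 2) (ONH k n)) = !![0, 0; 0, 0] := by
      ext i j
      fin_cases i <;> fin_cases j <;> simp
    intro a b h
    cases h with
    | dot_dot i j h =>
      simp only [map_add, map_mul, map_zero, FreeAlgebra.lift_ι_apply, dGen, key, addm, zerom]
      have h' := dot_dot (k := k) h
      refine mat _ _ _ _ _ _ _ _ h' ?_ (add_zero _) h'
      change -(x k n i * x k n j ^ 2) + x k n i ^ 2 * x k n j +
        (-(x k n j * x k n i ^ 2) + x k n j ^ 2 * x k n i) = 0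
      rw [sq_comm _ _ h', sq_comm _ _ (dot_dot h.symm)]
      abel
    | cross_cross i j h =>
      simp only [map_add, map_mul, map_zero, FreeAlgebra.lift_ι_apply, dGen, key, addm, zerom]
      have h' := cross_cross (k := k) h
      refine mat _ _ _ _ _ _ _ _ h' ?_ (add_zero _) h'
      rw [mul_one, one_mul, mul_one, one_mul]
      abel
    | cross_sq i =>
      simp only [map_mul, map_zero, FreeAlgebra.lift_ι_apply, dGen, key, zerom]
      refine mat _ _ _ _ _ _ _ _ (cross_sq i) ?_ rfl (cross_sq i)
      rw [mul_one, one_mul]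
      abel
    | braid i j h =>
      simp only [map_mul, FreeAlgebra.lift_ι_apply, dGen, key, key']
      have h' := braid (k := k) h
      refine mat _ _ _ _ _ _ _ _ (congrArg Neg.neg h') ?_ rfl h'
      change del k n i * del k n j * 1 + (-(del k n i * 1) + 1 * del k n j) * del k n i =
        del k n j * del k n i * 1 + (-(del k n j * 1) + 1 * del k n i) * del k n j
      simp only [mul_one, one_mul, add_mul, neg_mul, cross_sq, neg_zero, zero_add]
      abel
    | cross_dot i j h₁ h₂ =>
      simp only [map_add, map_mul, map_zero, FreeAlgebra.lift_ι_apply, dGen, key, addm, zerom]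
      have h' := cross_dot (k := k) h₁ h₂
      refine mat _ _ _ _ _ _ _ _ h' ?_ (add_zero _) h'
      change -(del k n i * x k n j ^ 2) + 1 * x k n j +
        (-(x k n j * 1) + x k n j ^ 2 * del k n i) = 0
      rw [sq_comm _ _ h', mul_one, one_mul]
      abel
    | slide_left i =>
      simp only [map_add, map_mul, map_one, FreeAlgebra.lift_ι_apply, dGen, key, addm,
        Matrix.one_fin_two]
      have h' := slide_left (k := k) i
      refine mat _ _ _ _ _ _ _ _ h' ?_ (add_zero _) h'
      change -(x k n (lo i) * 1) + x k n (lo i) ^ 2 * del k n i +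
        (-(del k n i * x k n (hi i) ^ 2) + 1 * x k n (hi i)) = 0
      have e₁ := congrArg (x k n (lo i) * ·) h'
      have e₂ := congrArg (· * x k n (hi i)) h'
      simp only [mul_add, add_mul, mul_one, one_mul, ← mul_assoc] at e₁ e₂
      rw [pow_two, pow_two, mul_one, one_mul, ← mul_assoc]
      have e₁' := eq_sub_of_add_eq e₁
      have e₂' := eq_sub_of_add_eq' e₂
      rw [e₁', e₂']
      abel
    | slide_right i =>
      simp only [map_add, map_mul, map_one, FreeAlgebra.lift_ι_apply, dGen, key, addm,
        Matrix.one_fin_two]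
      have h' := slide_right (k := k) i
      refine mat _ _ _ _ _ _ _ _ h' ?_ (add_zero _) h'
      change -(del k n i * x k n (lo i) ^ 2) + 1 * x k n (lo i) +
        (-(x k n (hi i) * 1) + x k n (hi i) ^ 2 * del k n i) = 0
      have e₁ := congrArg (x k n (hi i) * ·) h'
      have e₂ := congrArg (· * x k n (lo i)) h'
      simp only [mul_add, add_mul, mul_one, one_mul, ← mul_assoc] at e₁ e₂
      rw [pow_two, pow_two, mul_one, one_mul, ← mul_assoc]
      have e₁' := eq_sub_of_add_eq' e₁
      have e₂' := eq_sub_of_add_eq e₂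
      rw [e₁', e₂']
      abel⟩

/-- The differential on the odd nilHecke algebra: the super-derivation with `d x_i = x_i ^ 2` and
`d ∂_i = 1`. -/
def d : ONH k n →ₗ[k] ONH k n where
  toFun a := triang k n a 0 1
  map_add' a b := by simp
  map_smul' r a := by simp

variable {k n}

theorem triang_gen (g : ONHGen n) :
    triang k n (gen k n g) = !![-gen k n g, dGen g; 0, gen k n g] :=
  (RingQuot.liftAlgHom_mkAlgHom_apply k _ _ (FreeAlgebra.ι k g)).trans
    (FreeAlgebra.lift_ι_apply _ _)

theorem d_x (i : Fin n) : d k n (x k n i) = x k n i ^ 2 :=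
  congrFun (congrFun (triang_gen (k := k) (ONHGen.dot i)) 0) 1

theorem d_del (i : Fin (n - 1)) : d k n (del k n i) = 1 :=
  congrFun (congrFun (triang_gen (k := k) (ONHGen.cross i)) 0) 1

end ONH

end OddNil

end

/-! The action of `ONH_n` on `Z_n` is well defined because the operators `∂_i` satisfy the nilHecke
relations and annihilate the twisted symmetric polynomials `θ w_0 (OΛ_n)`; by the twisted Leibniz
rule they are then right linear (`divDiff_thetaW0`).

Bijectivity is a Morita-type argument that needs no basis of `ONH_n` and no freeness over `OΛ_n`.
Let `D` be the longest crossing, a product of `n (n - 1) / 2` crossings. It has three properties.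
(a) `D` generates `ONH_n` as a two-sided ideal (`ONH.one_mem_span_longest`): multiplying by dots on
the right strips crossings off `D` one at a time until `1` is left. (b) `∂_i D = 0`, so `c D = (c ·
1) D` for every `c`, where `c · 1` is the polynomial obtained by letting `c` act on `1`
(`ONH.mul_longest`). (c) `D` maps `OPol_n` into the twisted symmetric polynomials
(`ONH.longest_apply_mem_twistedOSym`): polynomials of degree at most `n (n - 1) / 2` generate
`OPol_n` over these, and `D` is right linear and sends such polynomials to constants.

By (a), `1` is a sum of terms `a D b`. If `c` acts as zero, then `c a D b = (c a · 1) D b = 0` by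
(b), so `c = 0`. If `F` is right linear, then by (c) the argument of `F` in `F (a D b f z)` is `(a ·
1) s z` with `s = D b f` twisted symmetric, so `F` composed with `a D b` is the action of `g D b`,
where `F ((a · 1) z) = g z`; hence `F` lies in the image.

Both differentials are super-derivations, so they are compared on generators. For `∂_i` the graded
commutator with `d` on `OPol_n` is `1 - s_i`, and the choice of `d z` contributes the missing `s_i`,
because exactly one of two neighbouring variables occurs in `∑ {i-1} x_i`. -/

noncomputable section

namespace OddNil

/-! ### Superalgebras generated by odd elements -/

section WordPart

variable {k A ι : Type*} [CommRing k] [Ring A] [Algebra k A] {g : ι → A}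

theorem one_mem_wordPart : (1 : A) ∈ wordPart k g 0 :=
  Submodule.subset_span ⟨[], by simp⟩

theorem gen_mem_wordPart (i : ι) : g i ∈ wordPart k g 1 :=
  Submodule.subset_span ⟨[i], by simp⟩

theorem mul_mem_wordPart {p q : ZMod 2} {a b : A} (ha : a ∈ wordPart k g p)
    (hb : b ∈ wordPart k g q) : a * b ∈ wordPart k g (p + q) := by
  have hab := Submodule.mul_mem_mul ha hb
  rw [wordPart, wordPart, Submodule.span_mul_span] at hab
  refine Submodule.span_mono ?_ hab
  rintro _ ⟨_, ⟨l, rfl, rfl⟩, _, ⟨l', rfl, rfl⟩, rfl⟩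
  exact ⟨l ++ l', by simp⟩

theorem wordPart_gradedMonoid : SetLike.GradedMonoid (wordPart k g) where
  one_mem := one_mem_wordPart
  mul_mem _ _ _ _ := mul_mem_wordPart

theorem wordPart_induction {P : ZMod 2 → A → Prop} (one : P 0 1)
    (zero : ∀ p, P p 0) (add : ∀ p a b, P p a → P p b → P p (a + b))
    (smul : ∀ p (r : k) a, P p a → P p (r • a))
    (gen_mul : ∀ p i a, a ∈ wordPart k g p → P p a → P (p + 1) (g i * a)) {p : ZMod 2} {a : A}
    (ha : a ∈ wordPart k g p) : P p a := by
  induction ha using Submodule.span_induction with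
  | mem a ha =>
    obtain ⟨l, rfl, rfl⟩ := ha
    induction l with
    | nil => simpa using one
    | cons i l ih =>
      have := gen_mul _ i _ (Submodule.subset_span ⟨l, rfl, rfl⟩) ih
      simpa using this
  | zero => exact zero p
  | add a b _ _ ha hb => exact add p a b ha hb
  | smul r a _ ha => exact smul p r a ha

/-- Operators with a twisted Leibniz rule are controlled by their effect on `g i * a`, so this
induction suits all later identities between such operators and spares them any parity bookkeeping.
-/
theorem word_induction (htop : ⨆ p, wordPart k g p = ⊤) {P : A → Prop} (one : P 1)
    (add : ∀ a b, P a → P b → P (a + b)) (smul : ∀ (r : k) a, P a → P (r • a))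
    (gen_mul : ∀ i a, P a → P (g i * a)) (a : A) : P a := by
  have zero : P 0 := by simpa using smul 0 1 one
  have ha : a ∈ ⨆ p, wordPart k g p := by rw [htop]; trivial
  induction ha using Submodule.iSup_induction' with
  | mem p a ha =>
    exact wordPart_induction (P := fun _ a => P a) one (fun _ => zero) (fun _ => add)
      (fun _ => smul) (fun _ i a _ => gen_mul i a) ha
  | zero => exact zero
  | add a b _ _ ha hb => exact add a b ha hb

theorem iSup_wordPart (hg : Algebra.adjoin k (Set.range g) = ⊤) :
    ⨆ p, wordPart k g p = ⊤ := by
  rw [eq_top_iff]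
  intro a _
  have ha : a ∈ Subalgebra.toSubmodule (Algebra.adjoin k (Set.range g)) := by rw [hg]; trivial
  rw [Algebra.adjoin_eq_span] at ha
  refine Submodule.span_le.2 ?_ ha
  intro b hb
  obtain ⟨l, hl, rfl⟩ := Submonoid.exists_list_of_mem_closure hb
  have : ∃ l' : List ι, l'.map g = l := by
    clear hb ha
    induction l with
    | nil => exact ⟨[], rfl⟩
    | cons b l ih =>
      obtain ⟨l', rfl⟩ := ih fun y hy => hl y (List.mem_cons_of_mem _ hy)
      obtain ⟨i, rfl⟩ := hl b List.mem_cons_self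
      exact ⟨i :: l', rfl⟩
  obtain ⟨l', rfl⟩ := this
  exact Submodule.mem_iSup_of_mem (l'.length : ZMod 2) (Submodule.subset_span ⟨l', rfl, rfl⟩)

theorem zmod_two_eq_zero_or_one (p : ZMod 2) : p = 0 ∨ p = 1 := by
  revert p; decide

theorem iSup_zmod_two {M : Type*} [AddCommGroup M] [Module k M] (gr : ZMod 2 → Submodule k M) :
    ⨆ p, gr p = gr 0 ⊔ gr 1 := by
  apply le_antisymm
  · refine iSup_le fun p => ?_
    rcases zmod_two_eq_zero_or_one p with rfl | rfl
    · exact le_sup_left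
    · exact le_sup_right
  · exact sup_le (le_iSup gr 0) (le_iSup gr 1)

theorem isInternal_of_disjoint {M : Type*} [AddCommGroup M] [Module k M]
    {gr : ZMod 2 → Submodule k M} (h : ∀ m ∈ gr 0, m ∈ gr 1 → m = 0) (htop : ⨆ p, gr p = ⊤) :
    DirectSum.IsInternal gr := by
  refine (DirectSum.isInternal_submodule_iff_isCompl gr (i := 0) (j := 1) (by decide) ?_).2 ⟨?_, ?_⟩
  · ext p
    simpa using zmod_two_eq_zero_or_one p
  · rw [Submodule.disjoint_def]
    exact h
  · rw [codisjoint_iff, ← iSup_zmod_two, htop]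

/-- Off-diagonal matrices multiply like odd elements, so `τ` puts even words on the diagonal and odd
words off it. This separates the two parts over every ring, whereas the sign involution does not
when `2 = 0`. -/
theorem matrix_map_of_mem_wordPart (τ : A →ₐ[k] Matrix (Fin 2) (Fin 2) A)
    (hτ : ∀ i, τ (g i) = !![0, g i; g i, 0]) {p : ZMod 2} {a : A} (ha : a ∈ wordPart k g p) :
    τ a = if p = 0 then !![a, 0; 0, a] else !![0, a; a, 0] := by
  refine wordPart_induction (P := fun p a => τ a = if p = 0 then !![a, 0; 0, a] else !![0, a; a, 0])
    ?_ ?_ ?_ ?_ ?_ ha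
  · simp [Matrix.one_fin_two]
  · intro p
    split_ifs <;> ext i j <;> fin_cases i <;> fin_cases j <;> simp
  · intro p a b ha hb
    rw [map_add, ha, hb]
    split_ifs <;> ext i j <;> fin_cases i <;> fin_cases j <;> simp
  · intro p r a ha
    rw [map_smul, ha]
    split_ifs <;> ext i j <;> fin_cases i <;> fin_cases j <;> simp
  · intro p i a _ ha
    rw [map_mul, ha, hτ]
    rcases zmod_two_eq_zero_or_one p with rfl | rfl
    · simp
    · have : (1 + 1 : ZMod 2) = 0 := by decide
      simp [this]

theorem eq_zero_of_mem_wordPart (τ : A →ₐ[k] Matrix (Fin 2) (Fin 2) A)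
    (hτ : ∀ i, τ (g i) = !![0, g i; g i, 0]) {a : A} (h₀ : a ∈ wordPart k g 0)
    (h₁ : a ∈ wordPart k g 1) : a = 0 := by
  have h := (matrix_map_of_mem_wordPart τ hτ h₀).symm.trans (matrix_map_of_mem_wordPart τ hτ h₁)
  simpa using congrFun (congrFun h 0) 0

theorem neg_one_uzpow_add_one_smul {M : Type*} [AddCommGroup M] (p : ZMod 2) (m : M) :
    (-1 : ℤˣ) ^ (p + 1) • m = -((-1 : ℤˣ) ^ p • m) := by
  rw [uzpow_add, uzpow_one, mul_neg_one, Units.neg_smul]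

/-- On an algebra generated by odd elements `g i`, a linear map with
`d (g i * b) = d (g i) * b - g i * d b` is the differential of a dg algebra as soon as `d (g i)` is
even and `d (d (g i)) = 0`. -/
theorem isDGAlgebra_wordPart (htop : ⨆ p, wordPart k g p = ⊤)
    (τ : A →ₐ[k] Matrix (Fin 2) (Fin 2) A) (hτ : ∀ i, τ (g i) = !![0, g i; g i, 0])
    (d : A →ₗ[k] A) (d_one : d 1 = 0) (d_gen : ∀ i b, d (g i * b) = d (g i) * b - g i * d b)
    (d_even : ∀ i, d (g i) ∈ wordPart k g 0) (d_d : ∀ i, d (d (g i)) = 0) :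
    IsDGAlgebra (wordPart k g) d := by
  have leibniz : ∀ p, ∀ a ∈ wordPart k g p, ∀ b,
      d (a * b) = d a * b + (-1 : ℤˣ) ^ p • (a * d b) := by
    intro p a ha
    refine wordPart_induction (P := fun p a => ∀ b, d (a * b) = d a * b + (-1 : ℤˣ) ^ p • (a * d b))
      ?_ ?_ ?_ ?_ ?_ ha
    · simp [d_one]
    · simp
    · intro p a b ha hb c
      rw [add_mul, map_add, ha, hb, map_add, add_mul, add_mul, smul_add]
      abel
    · intro p r a ha b
      rw [smul_mul_assoc, map_smul, ha, map_smul, smul_mul_assoc, smul_mul_assoc, smul_add,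
        smul_comm]
    · intro p i a _ ha b
      rw [mul_assoc, d_gen, ha, d_gen, neg_one_uzpow_add_one_smul, mul_add, mul_smul_comm, sub_mul]
      simp only [mul_assoc]
      abel
  refine ⟨wordPart_gradedMonoid, isInternal_of_disjoint (fun a => eq_zero_of_mem_wordPart τ hτ) htop,
    ?_, ?_, leibniz⟩
  · intro p a ha
    refine wordPart_induction (P := fun p a => d a ∈ wordPart k g (p + 1)) ?_ ?_ ?_ ?_ ?_ ha
    · rw [d_one]; exact zero_mem _
    · intro p; rw [map_zero]; exact zero_mem _
    · intro p a b ha hb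
      rw [map_add]; exact add_mem ha hb
    · intro p r a ha
      rw [map_smul]; exact Submodule.smul_mem _ _ ha
    · intro p i a ha hda
      have e : p + 1 + 1 = p := by rw [add_assoc, CharTwo.add_self_eq_zero, add_zero]
      rw [d_gen, e]
      have h₁ := mul_mem_wordPart (d_even i) ha
      have h₂ := mul_mem_wordPart (gen_mem_wordPart (k := k) i) hda
      rw [zero_add] at h₁
      rw [add_comm, e] at h₂
      exact sub_mem h₁ h₂
  · intro a
    induction a using word_induction htop with
    | one => rw [d_one, map_zero]
    | add a b ha hb => rw [map_add, map_add, ha, hb, add_zero]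
    | smul r a ha => rw [map_smul, map_smul, ha, smul_zero]
    | gen_mul i a ha =>
      -- As `d (g i)` is even, the term `d (g i) * d a` arises twice, with opposite signs.
      rw [d_gen, map_sub, leibniz 0 _ (d_even i), d_d, d_gen, ha, uzpow_zero, one_smul]
      simp

end WordPart

/-! ### Skew polynomials and odd divided differences -/

theorem coe_lo {n : ℕ} (i : Fin (n - 1)) : (lo i : ℕ) = i := rfl

theorem coe_hi {n : ℕ} (i : Fin (n - 1)) : (hi i : ℕ) = i + 1 := rfl

theorem coe_swap {n : ℕ} (i : Fin (n - 1)) (j : Fin n) :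
    (Equiv.swap (lo i) (hi i) j : ℕ) =
      if (j : ℕ) = i then (i : ℕ) + 1 else if (j : ℕ) = i + 1 then (i : ℕ) else j := by
  rw [Equiv.swap_apply_def]
  simp only [Fin.ext_iff, coe_lo, coe_hi]
  split_ifs <;> simp [coe_lo, coe_hi]

namespace OPol

variable {k : Type*} [CommRing k] {n : ℕ}

theorem gen_induction {P : OPol k n → Prop} (one : P 1) (add : ∀ a b, P a → P b → P (a + b))
    (smul : ∀ (r : k) a, P a → P (r • a)) (x_mul : ∀ i a, P a → P (x k n i * a))
    (a : OPol k n) : P a :=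
  word_induction (iSup_part k n) one add smul x_mul a

theorem x_mem_part (i : Fin n) : x k n i ∈ part k n 1 := gen_mem_wordPart i

theorem mul_mem_part {p q : ZMod 2} {a b : OPol k n} (ha : a ∈ part k n p)
    (hb : b ∈ part k n q) : a * b ∈ part k n (p + q) := mul_mem_wordPart ha hb

/-- The homomorphism sending `a` to the matrix of multiplication by `a` on the even and odd parts,
which detects the parity. -/
def parityMatrix : OPol k n →ₐ[k] Matrix (Fin 2) (Fin 2) (OPol k n) :=
  lift (fun i => !![0, x k n i; x k n i, 0]) (by
    intro i j h
    ext a b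
    fin_cases a <;> fin_cases b <;> simp [x_anticomm h])

theorem parityMatrix_x (i : Fin n) :
    parityMatrix (x k n i) = !![0, x k n i; x k n i, 0] := lift_x ..

theorem d_x_mul (i : Fin n) (f : OPol k n) :
    d k n (x k n i * f) = x k n i ^ 2 * f - x k n i * d k n f := by
  rw [d_mul, d_x, parity_x, neg_mul, sub_eq_add_neg]

theorem x_sq_mem_part (i : Fin n) : x k n i ^ 2 ∈ part k n 0 := by
  have h := mul_mem_part (x_mem_part (k := k) i) (x_mem_part i)
  rwa [CharTwo.add_self_eq_zero, ← pow_two] at h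

variable (k n) in
theorem isDGAlgebra : IsDGAlgebra (part k n) (d k n) := by
  change IsDGAlgebra (wordPart k (x k n)) (d k n)
  refine isDGAlgebra_wordPart (iSup_part k n) parityMatrix parityMatrix_x (d k n) d_one ?_ ?_ ?_
  · intro i b
    rw [d_x_mul, d_x]
  · intro i
    rw [d_x]
    exact x_sq_mem_part i
  · intro i
    rw [d_x, pow_two, d_x_mul, d_x]
    simp [pow_two, mul_assoc]

theorem eq_zero_of_mem_part {a : OPol k n} (h₀ : a ∈ part k n 0) (h₁ : a ∈ part k n 1) : a = 0 :=
  eq_zero_of_mem_wordPart parityMatrix parityMatrix_x h₀ h₁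

theorem d_parity (f : OPol k n) : d k n (parity k n f) = -parity k n (d k n f) := by
  induction f using gen_induction with
  | one => simp [d_one]
  | add a b ha hb => simp only [map_add, ha, hb, neg_add]
  | smul r a ha => simp only [map_smul, ha, smul_neg]
  | x_mul i a ha =>
    rw [map_mul, parity_x, neg_mul, map_neg, d_x_mul, d_x_mul, ha, map_sub, map_mul, map_mul,
      map_pow, parity_x, neg_sq]
    simp

theorem monomialMap_mem_part (c : Fin n → k) (w : Equiv.Perm (Fin n)) {p : ZMod 2} {a : OPol k n}
    (ha : a ∈ part k n p) : monomialMap c w a ∈ part k n p := by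
  refine wordPart_induction (P := fun p a => monomialMap c w a ∈ part k n p) ?_ ?_ ?_ ?_ ?_ ha
  · rw [map_one]; exact one_mem_wordPart
  · intro p; rw [map_zero]; exact zero_mem _
  · intro p a b ha hb; rw [map_add]; exact add_mem ha hb
  · intro p r a ha; rw [map_smul]; exact Submodule.smul_mem _ _ ha
  · intro p i a _ ha
    rw [map_mul, add_comm]
    refine mul_mem_part ?_ ha
    rw [monomialMap, lift_x]
    exact Submodule.smul_mem _ _ (x_mem_part _)

theorem thetaW0_mem_part {p : ZMod 2} {a : OPol k n} (ha : a ∈ part k n p) :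
    thetaW0 k n a ∈ part k n p :=
  monomialMap_mem_part _ _ (monomialMap_mem_part _ _ ha)

theorem divDiff_one (i : Fin (n - 1)) : divDiff k n i 1 = 0 := by
  have h := divDiff_mul (k := k) i (1 : OPol k n) 1
  rw [mul_one, map_one (perm k n _), map_one (parity k n), one_mul, mul_one] at h
  exact left_eq_add.1 h

theorem divDiff_x_mul (i : Fin (n - 1)) (j : Fin n) (f : OPol k n) :
    divDiff k n i (x k n j * f) = (if j = lo i ∨ j = hi i then f else 0) -
      x k n (Equiv.swap (lo i) (hi i) j) * divDiff k n i f := by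
  rw [divDiff_mul, divDiff_x, perm_x, parity_x, neg_mul, ← sub_eq_add_neg, ite_mul, one_mul,
    zero_mul]

theorem divDiff_mul_right (i : Fin (n - 1)) (f : OPol k n) {g : OPol k n}
    (hg : divDiff k n i g = 0) : divDiff k n i (f * g) = divDiff k n i f * g := by
  rw [divDiff_mul, hg, mul_zero, add_zero]

/-- The condition `j ∈ {i, i + 1}` is invariant under `s_i`, so the two terms of `∂_i ∂_i (x_j a)`
that carry `∂_i a` cancel. -/
theorem divDiff_divDiff (i : Fin (n - 1)) (f : OPol k n) :
    divDiff k n i (divDiff k n i f) = 0 := by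
  induction f using gen_induction with
  | one => rw [divDiff_one, map_zero]
  | add a b ha hb => rw [map_add, map_add, ha, hb, add_zero]
  | smul r a ha => rw [map_smul, map_smul, ha, smul_zero]
  | x_mul j a ha =>
    rw [divDiff_x_mul, map_sub, divDiff_x_mul, ha, mul_zero, sub_zero]
    by_cases h₁ : j = lo i
    · simp [h₁]
    · by_cases h₂ : j = hi i
      · simp [h₂]
      · simp [h₁, h₂, Equiv.swap_apply_of_ne_of_ne]

theorem divDiff_ite (i : Fin (n - 1)) (c : Prop) [Decidable c] (f : OPol k n) :
    divDiff k n i (if c then f else 0) = if c then divDiff k n i f else 0 := by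
  rw [apply_ite (divDiff k n i), map_zero]

theorem divDiff_comm {i j : Fin (n - 1)} (h : (i : ℕ) + 1 < j ∨ (j : ℕ) + 1 < i) (f : OPol k n) :
    divDiff k n i (divDiff k n j f) + divDiff k n j (divDiff k n i f) = 0 := by
  induction f using gen_induction with
  | one => rw [divDiff_one, divDiff_one, map_zero, map_zero, add_zero]
  | add a b ha hb =>
    simp only [map_add]
    rw [add_add_add_comm, ha, hb, add_zero]
  | smul r a ha => simp only [map_smul]; rw [← smul_add, ha, smul_zero]
  | x_mul l a ha =>
    have h₁ : (l = lo i ∨ l = hi i) ↔ (Equiv.swap (lo j) (hi j) l = lo i ∨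
        Equiv.swap (lo j) (hi j) l = hi i) := by
      simp only [Fin.ext_iff, coe_swap, coe_lo, coe_hi]
      split_ifs <;> omega
    have h₂ : (l = lo j ∨ l = hi j) ↔ (Equiv.swap (lo i) (hi i) l = lo j ∨
        Equiv.swap (lo i) (hi i) l = hi j) := by
      simp only [Fin.ext_iff, coe_swap, coe_lo, coe_hi]
      split_ifs <;> omega
    have h₃ : Equiv.swap (lo i) (hi i) (Equiv.swap (lo j) (hi j) l) =
        Equiv.swap (lo j) (hi j) (Equiv.swap (lo i) (hi i) l) := by
      simp only [Fin.ext_iff, coe_swap]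
      split_ifs <;> omega
    simp only [divDiff_x_mul, map_sub, ← h₁, ← h₂, h₃, divDiff_ite]
    have := congrArg (x k n (Equiv.swap (lo j) (hi j) (Equiv.swap (lo i) (hi i) l)) * ·) ha
    simp only [mul_add, mul_zero] at this
    rw [← this]
    abel

/-- Moving `x_l` through three operators leaves three terms without a variable. The middle one
contains `∂_i ∂_i` or `∂_j ∂_j` and vanishes; the outer two on one side match those on the other in
reverse order, because `s_i s_j` carries the pair of `∂_i` to the pair of `∂_j`. The remaining term
uses the braid relation for transpositions. -/
theorem divDiff_braid {i j : Fin (n - 1)} (h : (j : ℕ) = i + 1) (f : OPol k n) :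
    divDiff k n i (divDiff k n j (divDiff k n i f)) =
      divDiff k n j (divDiff k n i (divDiff k n j f)) := by
  induction f using gen_induction with
  | one => simp only [divDiff_one, map_zero]
  | add a b ha hb => simp only [map_add, ha, hb]
  | smul r a ha => simp only [map_smul, ha]
  | x_mul l a ha =>
    have h₁ : (l = lo i ∨ l = hi i) ↔
        (Equiv.swap (lo i) (hi i) (Equiv.swap (lo j) (hi j) l) = lo j ∨
        Equiv.swap (lo i) (hi i) (Equiv.swap (lo j) (hi j) l) = hi j) := by
      simp only [Fin.ext_iff, coe_swap, coe_lo, coe_hi]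
      split_ifs <;> omega
    have h₂ : (l = lo j ∨ l = hi j) ↔
        (Equiv.swap (lo j) (hi j) (Equiv.swap (lo i) (hi i) l) = lo i ∨
        Equiv.swap (lo j) (hi j) (Equiv.swap (lo i) (hi i) l) = hi i) := by
      simp only [Fin.ext_iff, coe_swap, coe_lo, coe_hi]
      split_ifs <;> omega
    have h₃ : Equiv.swap (lo i) (hi i) (Equiv.swap (lo j) (hi j) (Equiv.swap (lo i) (hi i) l)) =
        Equiv.swap (lo j) (hi j) (Equiv.swap (lo i) (hi i) (Equiv.swap (lo j) (hi j) l)) := by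
      have hl : (l : ℕ) = i ∨ (l : ℕ) = i + 1 ∨ (l : ℕ) = i + 1 + 1 ∨
          ((l : ℕ) ≠ i ∧ (l : ℕ) ≠ i + 1 ∧ (l : ℕ) ≠ i + 1 + 1) := by omega
      rw [Fin.ext_iff]
      simp only [coe_swap, h]
      have e₁ : (i : ℕ) + 1 + 1 ≠ i := by omega
      have e₂ : (i : ℕ) ≠ i + 1 + 1 := by omega
      rcases hl with hl | hl | hl | ⟨hl, hl', hl''⟩
      · simp [hl, e₁, e₂]
      · simp [hl, e₁, e₂]
      · simp [hl, e₁, e₂]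
      · simp [hl, hl', hl'']
    have hi' := divDiff_divDiff (k := k) i a
    have hj' := divDiff_divDiff (k := k) j a
    rw [divDiff_x_mul, map_sub, divDiff_ite, divDiff_x_mul, map_sub, map_sub, divDiff_ite,
      divDiff_ite, divDiff_x_mul, hi', ite_self, divDiff_x_mul, map_sub, divDiff_ite, divDiff_x_mul,
      map_sub, map_sub, divDiff_ite, divDiff_ite, divDiff_x_mul, hj', ite_self, h₃, ha,
      if_congr h₁ rfl rfl, if_congr h₂ rfl rfl]
    abel

theorem divDiff_mem_part (i : Fin (n - 1)) {p : ZMod 2} {a : OPol k n} (ha : a ∈ part k n p) :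
    divDiff k n i a ∈ part k n (p + 1) := by
  refine wordPart_induction (P := fun p a => divDiff k n i a ∈ part k n (p + 1)) ?_ ?_ ?_ ?_ ?_ ha
  · rw [divDiff_one]; exact zero_mem _
  · intro p; rw [map_zero]; exact zero_mem _
  · intro p a b ha hb; rw [map_add]; exact add_mem ha hb
  · intro p r a ha; rw [map_smul]; exact Submodule.smul_mem _ _ ha
  · intro p j a ha hda
    have e : p + 1 + 1 = p := by rw [add_assoc, CharTwo.add_self_eq_zero, add_zero]
    rw [divDiff_x_mul, e]
    have h := mul_mem_part (x_mem_part (Equiv.swap (lo i) (hi i) j)) hda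
    rw [add_comm, e] at h
    refine sub_mem ?_ h
    split_ifs
    · exact ha
    · exact zero_mem _

theorem divDiff_parity (i : Fin (n - 1)) (f : OPol k n) :
    divDiff k n i (parity k n f) = -parity k n (divDiff k n i f) := by
  induction f using gen_induction with
  | one => rw [map_one, divDiff_one, map_zero, neg_zero]
  | add a b ha hb => simp only [map_add, ha, hb, neg_add]
  | smul r a ha => simp only [map_smul, ha, smul_neg]
  | x_mul j a ha =>
    rw [map_mul, parity_x, neg_mul, map_neg, divDiff_x_mul, divDiff_x_mul, ha, map_sub, map_mul,
      parity_x, apply_ite (parity k n), map_zero]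
    simp

/-- The graded commutator of `d` and `∂_i`. -/
theorem d_divDiff (i : Fin (n - 1)) (f : OPol k n) :
    d k n (divDiff k n i f) + divDiff k n i (d k n f) =
      f - perm k n (Equiv.swap (lo i) (hi i)) f := by
  induction f using gen_induction with
  | one => rw [divDiff_one, d_one, map_zero, map_zero, map_one, sub_self, add_zero]
  | add a b ha hb =>
    simp only [map_add]
    rw [add_add_add_comm, ha, hb]; abel
  | smul r a ha => simp only [map_smul]; rw [← smul_add, ha, smul_sub]
  | x_mul j a ha =>
    -- The summand `x_j a - x_{s_i j} a` found here telescopes with `x_{s_i j} (a - s_i a)`,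
    -- supplied by the induction hypothesis, to `x_j a - s_i (x_j a)`.
    have hx : divDiff k n i (x k n j * (x k n j * a)) =
        (x k n j - x k n (Equiv.swap (lo i) (hi i) j)) * a +
          x k n (Equiv.swap (lo i) (hi i) j) ^ 2 * divDiff k n i a := by
      rw [divDiff_x_mul, divDiff_x_mul, mul_sub, pow_two, mul_assoc, sub_mul]
      by_cases h₁ : j = lo i
      · simp [h₁]; abel
      · by_cases h₂ : j = hi i
        · simp [h₂]; abel
        · simp [h₁, h₂, Equiv.swap_apply_of_ne_of_ne]
    rw [d_x_mul, map_sub, pow_two, mul_assoc, hx, divDiff_x_mul, divDiff_x_mul, map_sub, d_x_mul,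
      map_mul, perm_x, apply_ite (d k n), map_zero]
    have := congrArg (x k n (Equiv.swap (lo i) (hi i) j) * ·) ha
    simp only [mul_add, mul_sub] at this
    rw [sub_mul]
    rw [← sub_eq_zero] at this ⊢
    rw [← this]
    abel

end OPol

/-! ### Parity and differential on odd symmetric polynomials -/

section OSym

variable {k : Type*} [CommRing k] {n : ℕ}

theorem esymmOn_mem_part (T : Finset (Fin n)) (m : ℕ) :
    esymmOn k n T m ∈ OPol.part k n (m : ZMod 2) := by
  refine Submodule.sum_mem _ fun s hs => Submodule.subset_span ⟨s.sort (· ≤ ·), ?_, rfl⟩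
  rw [Finset.length_sort, (Finset.mem_powersetCard.1 hs).2]

/-- The generators `e_m` are homogeneous, so `OΛ_n` is a graded subalgebra: the even and odd
components of its elements stay inside. -/
theorem exists_homogeneous_of_mem_OSym {a : OPol k n} (ha : a ∈ OSym k n) :
    ∃ b ∈ OSym k n, ∃ c ∈ OSym k n, b ∈ OPol.part k n 0 ∧ c ∈ OPol.part k n 1 ∧ b + c = a := by
  induction ha using Algebra.adjoin_induction with
  | mem a ha =>
    obtain ⟨m, rfl⟩ := ha
    have h := esymmOn_mem_part (k := k) (Finset.univ : Finset (Fin n)) m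
    rcases zmod_two_eq_zero_or_one (m : ZMod 2) with hm | hm
    · rw [hm] at h
      exact ⟨_, esymm_mem m, 0, zero_mem _, h, zero_mem _, add_zero _⟩
    · rw [hm] at h
      exact ⟨0, zero_mem _, _, esymm_mem m, zero_mem _, h, zero_add _⟩
  | algebraMap r =>
    refine ⟨_, Subalgebra.algebraMap_mem _ r, 0, zero_mem _, ?_, zero_mem _, add_zero _⟩
    rw [Algebra.algebraMap_eq_smul_one]
    exact Submodule.smul_mem _ _ one_mem_wordPart
  | add a a' _ _ ha ha' =>
    obtain ⟨b, hb, c, hc, hb', hc', rfl⟩ := ha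
    obtain ⟨e, he, f, hf, he', hf', rfl⟩ := ha'
    exact ⟨b + e, add_mem hb he, c + f, add_mem hc hf, add_mem hb' he', add_mem hc' hf', by abel⟩
  | mul a a' _ _ ha ha' =>
    obtain ⟨b, hb, c, hc, hb', hc', rfl⟩ := ha
    obtain ⟨e, he, f, hf, he', hf', rfl⟩ := ha'
    refine ⟨b * e + c * f, add_mem (mul_mem hb he) (mul_mem hc hf),
      b * f + c * e, add_mem (mul_mem hb hf) (mul_mem hc he), ?_, ?_, by noncomm_ring⟩
    · have h₁ := OPol.mul_mem_part hb' he'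
      have h₂ := OPol.mul_mem_part hc' hf'
      rw [add_zero] at h₁
      rw [CharTwo.add_self_eq_zero] at h₂
      exact add_mem h₁ h₂
    · have h₁ := OPol.mul_mem_part hb' hf'
      have h₂ := OPol.mul_mem_part hc' he'
      rw [zero_add] at h₁
      rw [add_zero] at h₂
      exact add_mem h₁ h₂

theorem OSym.iSup_part : ⨆ p, OSym.part k n p = ⊤ := by
  rw [iSup_zmod_two, eq_top_iff]
  rintro ⟨a, ha⟩ -
  obtain ⟨b, hb, c, hc, hb', hc', rfl⟩ := exists_homogeneous_of_mem_OSym ha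
  exact Submodule.mem_sup.2 ⟨⟨b, hb⟩, hb', ⟨c, hc⟩, hc', rfl⟩

variable (k n) in
theorem OSym.isDGAlgebra : IsDGAlgebra (OSym.part k n) (OSym.d k n) where
  graded :=
    { one_mem := one_mem_wordPart (k := k) (g := OPol.x k n)
      mul_mem := fun _ _ _ _ ha hb => OPol.mul_mem_part ha hb }
  internal := isInternal_of_disjoint
    (fun _ h₀ h₁ => Subtype.ext (OPol.eq_zero_of_mem_part h₀ h₁)) OSym.iSup_part
  odd p a ha := (OPol.isDGAlgebra k n).odd p a ha
  sq_zero a := Subtype.ext ((OPol.isDGAlgebra k n).sq_zero a)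
  leibniz p a ha b := by
    apply Subtype.ext
    have h := (OPol.isDGAlgebra k n).leibniz p a ha b
    simp only [Units.smul_def] at h ⊢
    exact h

end OSym

/-! ### The dg bimodule `Z_n` -/

namespace ZBim

variable {k : Type*} [CommRing k] {n : ℕ}

theorem coeff_smul (f : OPol k n) (m : ZBim k n) : coeff k n (f • m) = f * coeff k n m := rfl

theorem mem_part_iff {p : ZMod 2} {m : ZBim k n} :
    m ∈ part k n p ↔ coeff k n m ∈ OPol.part k n p := Iff.rfl

theorem eq_zero_of_mem_part {p : ZMod 2} {m : ZBim k n} (h : m ∈ part k n p)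
    (h' : m ∈ part k n (p + 1)) : m = 0 := by
  rcases zmod_two_eq_zero_or_one p with rfl | rfl
  · exact OPol.eq_zero_of_mem_part h (by rwa [zero_add] at h')
  · exact OPol.eq_zero_of_mem_part (by rwa [CharTwo.add_self_eq_zero] at h') h

theorem dz_mem_part : dz k n ∈ OPol.part k n 1 :=
  Submodule.sum_mem _ fun i _ => nsmul_mem (OPol.x_mem_part i) _

/-- The mixed terms of the square cancel by anticommutation and the coefficients `0`, `1` are
idempotent. This is exactly the condition for the twisted differential `f ↦ d f ± f * dz` to square
to zero. -/
theorem dz_mul_dz : dz k n * dz k n = OPol.d k n (dz k n) := by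
  have hd : OPol.d k n (dz k n) = ∑ i : Fin n, bracket (i : ℕ) • OPol.x k n i ^ 2 := by
    rw [dz, map_sum]
    exact Finset.sum_congr rfl fun i _ => by rw [map_nsmul, OPol.d_x]
  have hs : ∀ T : Finset (Fin n),
      (∑ i ∈ T, bracket (i : ℕ) • OPol.x k n i) * (∑ i ∈ T, bracket (i : ℕ) • OPol.x k n i) =
        ∑ i ∈ T, bracket (i : ℕ) • OPol.x k n i ^ 2 := by
    intro T
    induction T using Finset.induction_on with
    | empty => simp
    | insert a T ha ih =>
      have hc : bracket (a : ℕ) • OPol.x k n a * (∑ i ∈ T, bracket (i : ℕ) • OPol.x k n i) +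
          (∑ i ∈ T, bracket (i : ℕ) • OPol.x k n i) * bracket (a : ℕ) • OPol.x k n a = 0 := by
        rw [Finset.mul_sum, Finset.sum_mul, ← Finset.sum_add_distrib]
        refine Finset.sum_eq_zero fun i hi => ?_
        have hia : a ≠ i := fun e => ha (e ▸ hi)
        rw [smul_mul_smul_comm, smul_mul_smul_comm, mul_comm (bracket (i : ℕ)), ← smul_add,
          OPol.x_anticomm hia, smul_zero]
      have hb : bracket (a : ℕ) * bracket (a : ℕ) = bracket (a : ℕ) := by
        rcases Nat.mod_two_eq_zero_or_one (a : ℕ) with h | h <;> simp [bracket, h]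
      rw [Finset.sum_insert ha, Finset.sum_insert ha, add_mul, mul_add, mul_add, ih,
        smul_mul_smul_comm, hb, ← pow_two, add_assoc, ← add_assoc (_ * _), hc, zero_add]
  rw [hd, ← hs, dz]

theorem d_d (m : ZBim k n) : d k n (d k n m) = 0 := by
  apply (coeff k n).injective
  have hp : OPol.parity k n (dz k n) = -dz k n := by
    rw [OPol.parity_of_mem dz_mem_part, uzpow_one, Units.neg_smul, one_smul]
  rw [coeff_d, coeff_d, map_add, map_add, (OPol.isDGAlgebra k n).sq_zero, OPol.d_mul, map_mul, hp,
    OPol.d_parity, OPol.parity_parity, ← dz_mul_dz, map_zero]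
  noncomm_ring

theorem d_smul (f : OPol k n) (m : ZBim k n) :
    d k n (f • m) = OPol.d k n f • m + OPol.parity k n f • d k n m := by
  apply (coeff k n).injective
  rw [map_add, coeff_d, coeff_smul, coeff_smul, coeff_smul, coeff_d, OPol.d_mul, map_mul]
  noncomm_ring

variable (k n) in
theorem isDGBimodule : IsDGBimodule (OPol.part k n) (OPol.d k n) (OSym.part k n) (OSym.d k n)
    (part k n) (d k n) where
  left_dg := OPol.isDGAlgebra k n
  right_dg := OSym.isDGAlgebra k n
  commute a b m := (mul_assoc a (coeff k n m) (OPol.thetaW0 k n b)).symm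
  internal := (OPol.isDGAlgebra k n).internal
  smul_mem p q a ha m hm := OPol.mul_mem_part ha hm
  op_smul_mem p q m hm b hb := OPol.mul_mem_part hm (OPol.thetaW0_mem_part hb)
  odd p m hm := by
    have hm' : coeff k n m ∈ OPol.part k n p := hm
    have h : OPol.parity k n (coeff k n m) ∈ OPol.part k n p := OPol.monomialMap_mem_part _ _ hm'
    rw [mem_part_iff, coeff_d]
    exact add_mem ((OPol.isDGAlgebra k n).odd p _ hm) (OPol.mul_mem_part h dz_mem_part)
  sq_zero := d_d
  left_leibniz p a ha m := by
    rw [d_smul, OPol.parity_of_mem ha]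
    simp only [Units.smul_def, smul_assoc]
  right_leibniz p m hm b := by
    rw [d_op_smul, parity_of_mem hm]
    simp only [Units.smul_def]
    rw [smul_comm]

end ZBim

theorem bracket_add_bracket_succ (m : ℕ) : bracket m + bracket (m + 1) = 1 := by
  simp only [bracket]; omega

/-! ### Divided differences annihilate twisted symmetric polynomials -/

section Tail

variable {k : Type*} [CommRing k] {n : ℕ}

variable (k n) in
/-- The elementary polynomial of degree `m` in the variables with index at least `j`. -/
def tailEsymm (j m : ℕ) : OPol k n := esymmOn k n (Finset.univ.filter fun i => j ≤ (i : ℕ)) m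

theorem tailEsymm_zero_left (m : ℕ) : tailEsymm k n 0 m = esymm k n m := by
  simp [tailEsymm, esymm]

theorem tailEsymm_zero (j : ℕ) : tailEsymm k n j 0 = 1 := esymmOn_zero _

theorem tailEsymm_succ (j : Fin n) (m : ℕ) :
    tailEsymm k n j (m + 1) =
      tailEsymm k n (j + 1) (m + 1) + OPol.x k n j * tailEsymm k n (j + 1) m := by
  have h : (Finset.univ.filter fun i : Fin n => (j : ℕ) ≤ (i : ℕ)) =
      insert j (Finset.univ.filter fun i : Fin n => (j : ℕ) + 1 ≤ (i : ℕ)) := by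
    ext i
    simp only [Finset.mem_filter, Finset.mem_insert, Finset.mem_univ, true_and, Fin.ext_iff]
    omega
  rw [tailEsymm, h, esymmOn_insert]
  · rfl
  · intro i hi
    exact Fin.lt_def.2 (Finset.mem_filter.1 hi).2

theorem tailEsymm_eq_zero {j m : ℕ} (h : n < j + m) (hj : j ≤ n) : tailEsymm k n j m = 0 := by
  rw [tailEsymm, esymmOn, Finset.powersetCard_eq_empty.2, Finset.sum_empty]
  have hc : (Finset.univ.filter fun i : Fin n => j ≤ (i : ℕ)).card ≤ (Finset.Ico j n).card :=
    Finset.card_le_card_of_injOn (fun i => (i : ℕ)) (fun i hi => by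
      simpa using hi) (fun i _ i' _ e => Fin.ext e)
  rw [Nat.card_Ico] at hc
  omega

theorem divDiff_thetaW0_x (i : Fin (n - 1)) (j : Fin n) (h₁ : j.rev ≠ lo i) (h₂ : j.rev ≠ hi i)
    (f : OPol k n) (hf : OPol.divDiff k n i f = 0) :
    OPol.divDiff k n i (OPol.thetaW0 k n (OPol.x k n j) * f) = 0 := by
  rw [OPol.thetaW0_x, smul_mul_assoc, map_smul, OPol.divDiff_x_mul, hf]
  simp [h₁, h₂]

/-- Odd symmetric polynomials (in the twisted form) are killed by the divided differences: the
statement for all truncations which do not separate the two variables of `∂_i`. -/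
theorem divDiff_tailEsymm (i : Fin (n - 1)) (t : ℕ) (j : ℕ) (ht : j + t = n)
    (hj : j ≠ ((lo i).rev : ℕ)) (m : ℕ) :
    OPol.divDiff k n i (OPol.thetaW0 k n (tailEsymm k n j m)) = 0 := by
  induction t using Nat.strong_induction_on generalizing j m with
  | _ t ih =>
    have hlo : ((lo i).rev : ℕ) = n - (i + 1) := by rw [Fin.val_rev, coe_lo]
    have hhi : ((hi i).rev : ℕ) = n - (i + 1 + 1) := by rw [Fin.val_rev, coe_hi]
    have hin : (i : ℕ) + 1 < n := by omega
    cases m with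
    | zero => rw [tailEsymm_zero, map_one, OPol.divDiff_one]
    | succ m =>
      rcases Nat.eq_zero_or_pos t with rfl | htpos
      · rw [tailEsymm_eq_zero (by omega) (by omega), map_zero, map_zero]
      -- Because `w_0` reverses the variables, those of `∂_i` come from the neighbouring indices
      -- `(hi i).rev` and `(lo i).rev`. When the tail starts at the first of these, the next shorter
      -- tail is the excluded one, so both variables are peeled off together; hence the strong
      -- induction.
      · have hjn : j < n := by omega
        by_cases hj' : j = ((hi i).rev : ℕ)
        · have hj₂ : j + 1 = ((lo i).rev : ℕ) := by omega
          have hz : ∀ m, OPol.divDiff k n i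
              (OPol.thetaW0 k n (tailEsymm k n ((lo i).rev + 1) m)) = 0 := fun m =>
            ih (t - 2) (by omega) _ (by omega) (by omega) m
          have e₁ := tailEsymm_succ (k := k) (hi i).rev m
          rw [← hj', hj₂] at e₁
          -- The twist `θ` gives neighbouring variables opposite signs, so the sum is `± (x_i -
          -- x_{i+1})`. Since `∂_i f = 0`, both `∂_i (x_i f)` and `∂_i (x_{i+1} f)` equal `f`.
          have hx : ∀ f, OPol.divDiff k n i f = 0 → OPol.divDiff k n i
              (OPol.thetaW0 k n (OPol.x k n (hi i).rev) * f +
                OPol.thetaW0 k n (OPol.x k n (lo i).rev) * f) = 0 := by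
            intro f hf
            rw [OPol.thetaW0_x, OPol.thetaW0_x, Fin.rev_rev, Fin.rev_rev, coe_lo, coe_hi, pow_succ,
              mul_neg_one, smul_mul_assoc, smul_mul_assoc, map_add, map_smul, map_smul,
              OPol.divDiff_x_mul, OPol.divDiff_x_mul, hf]
            simp
          -- Up to sign this is `∂_i (x_{i+1} x_i f) = x_i f - x_i ∂_i (x_i f)`, and `∂_i (x_i f) =
          -- f`.
          have hxx : ∀ f, OPol.divDiff k n i f = 0 → OPol.divDiff k n i
              (OPol.thetaW0 k n (OPol.x k n (hi i).rev) *
                (OPol.thetaW0 k n (OPol.x k n (lo i).rev) * f)) = 0 := by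
            intro f hf
            rw [OPol.thetaW0_x, OPol.thetaW0_x, Fin.rev_rev, Fin.rev_rev, smul_mul_assoc,
              smul_mul_assoc, mul_smul_comm, map_smul, map_smul,
              OPol.divDiff_x_mul, OPol.divDiff_x_mul, hf]
            simp
          rw [e₁, tailEsymm_succ]
          cases m with
          | zero =>
            simp only [map_add (OPol.thetaW0 k n), map_mul (OPol.thetaW0 k n), tailEsymm_zero,
              map_one (OPol.thetaW0 k n)]
            rw [add_assoc, map_add, hz, zero_add, add_comm]
            exact hx 1 (OPol.divDiff_one i)
          | succ m =>
            rw [tailEsymm_succ]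
            simp only [map_add (OPol.thetaW0 k n), map_mul (OPol.thetaW0 k n)]
            -- With `a`, `b` the two peeled variables, the polynomial is regrouped as `e_{m+2} + (a
            -- + b) e_{m+1} + a b e_m`, where the `e`'s belong to the tail beyond both.
            rw [mul_add, add_assoc, map_add, hz, zero_add,
              ← add_assoc, add_comm (OPol.thetaW0 k n (OPol.x k n (lo i).rev) * _), map_add,
              hx _ (hz _), hxx _ (hz _), add_zero]
        · have e := tailEsymm_succ (k := k) ⟨j, hjn⟩ m
          have hz : ∀ m, OPol.divDiff k n i
              (OPol.thetaW0 k n (tailEsymm k n (j + 1) m)) = 0 := fun m =>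
            ih (t - 1) (by omega) _ (by omega) (by omega) m
          change tailEsymm k n j (m + 1) = tailEsymm k n (j + 1) (m + 1) + _ at e
          rw [e, map_add, map_add, hz, zero_add, map_mul]
          refine divDiff_thetaW0_x i _ ?_ ?_ _ (hz m)
          · intro h
            rw [← h, Fin.rev_rev] at hj
            exact hj rfl
          · intro h
            rw [← h, Fin.rev_rev] at hj'
            exact hj' rfl

/-- The kernel of `∂_i` is closed under products by `OPol.divDiff_mul_right`, so the generators
suffice. This is what makes `∂_i` an endomorphism of the right module `Z_n`. -/
theorem divDiff_thetaW0 (i : Fin (n - 1)) {a : OPol k n} (ha : a ∈ OSym k n) :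
    OPol.divDiff k n i (OPol.thetaW0 k n a) = 0 := by
  induction ha using Algebra.adjoin_induction with
  | mem a ha =>
    obtain ⟨m, rfl⟩ := ha
    -- The full set of variables is the tail at `0`; it is not the excluded one, as `lo i` is never
    -- the last variable.
    by_cases h : ((lo i).rev : ℕ) = 0
    · rw [Fin.val_rev, coe_lo] at h
      omega
    · rw [← tailEsymm_zero_left]
      exact divDiff_tailEsymm i n 0 (zero_add n) (fun e => h e.symm) m
  | algebraMap r =>
    rw [AlgHom.commutes, Algebra.algebraMap_eq_smul_one, map_smul, OPol.divDiff_one, smul_zero]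
  | add a b _ _ ha hb => rw [map_add, map_add, ha, hb, add_zero]
  | mul a b _ _ ha hb => rw [map_mul, OPol.divDiff_mul_right i _ hb, ha, zero_mul]

end Tail

/-! ### The dg algebra of right linear endomorphisms -/

namespace EndZ

variable {k : Type*} [CommRing k] {n : ℕ}

theorem ext_coeff {F G : EndZ k n}
    (h : ∀ m, ZBim.coeff k n (F m) = ZBim.coeff k n (G m)) : F = G :=
  LinearMap.ext fun m => (ZBim.coeff k n).injective (h m)

theorem coeff_map_mul (F : EndZ k n) (f : OPol k n) (a : OSym k n) :
    ZBim.coeff k n (F ((f * OPol.thetaW0 k n a) • ZBim.z k n)) =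
      ZBim.coeff k n (F (f • ZBim.z k n)) * OPol.thetaW0 k n a := by
  have h : (f * OPol.thetaW0 k n a) • ZBim.z k n = MulOpposite.op a • (f • ZBim.z k n) := by
    apply (ZBim.coeff k n).injective
    rw [ZBim.coeff_op_smul, ZBim.coeff_smul_z, ZBim.coeff_smul_z]
  rw [h, map_smul, ZBim.coeff_op_smul]

/-- Left multiplication by a skew polynomial. -/
def leftMul (f : OPol k n) : EndZ k n where
  toFun m := f • m
  map_add' := smul_add f
  map_smul' a m := by
    obtain ⟨a, rfl⟩ := MulOpposite.op_surjective a
    exact (ZBim.isDGBimodule k n).commute f a m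

theorem coeff_leftMul (f : OPol k n) (m : ZBim k n) :
    ZBim.coeff k n (leftMul f m) = f * ZBim.coeff k n m := rfl

/-- The divided difference operator on `Z_n`. -/
def crossing (i : Fin (n - 1)) : EndZ k n where
  toFun m := OPol.divDiff k n i (ZBim.coeff k n m) • ZBim.z k n
  map_add' a b := by rw [map_add, map_add, add_smul]
  map_smul' a m := by
    obtain ⟨a, rfl⟩ := MulOpposite.op_surjective a
    apply (ZBim.coeff k n).injective
    rw [RingHom.id_apply, ZBim.coeff_op_smul, ZBim.coeff_op_smul, ZBim.coeff_smul_z,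
      ZBim.coeff_smul_z, OPol.divDiff_mul_right i _ (divDiff_thetaW0 i a.2)]

theorem coeff_crossing (i : Fin (n - 1)) (m : ZBim k n) :
    ZBim.coeff k n (crossing i m) = OPol.divDiff k n i (ZBim.coeff k n m) :=
  ZBim.coeff_smul_z _

theorem one_mem_part : (1 : EndZ k n) ∈ part k n 0 := by
  intro q m hm
  rw [add_zero]
  exact hm

theorem mul_mem_part {p q : ZMod 2} {F G : EndZ k n} (hF : F ∈ part k n p)
    (hG : G ∈ part k n q) : F * G ∈ part k n (p + q) := by
  intro r m hm
  have h := hF _ _ (hG r m hm)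
  rwa [add_assoc, add_comm q p] at h

theorem eq_zero_of_mem_part {p : ZMod 2} {F : EndZ k n} (h : F ∈ part k n p)
    (h' : F ∈ part k n (p + 1)) : F = 0 := by
  ext m
  have hm : m ∈ ⨆ q, ZBim.part k n q := by rw [ZBim.iSup_part]; trivial
  induction hm using Submodule.iSup_induction' with
  | mem q m hm =>
    have h₁ := h' q m hm
    rw [← add_assoc] at h₁
    exact ZBim.eq_zero_of_mem_part (h q m hm) h₁
  | zero => rw [map_zero, map_zero]
  | add a b _ _ ha hb => rw [map_add, ha, hb, map_add]

theorem conj_mul_apply (F G : EndZ k n) (m : ZBim k n) :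
    conj k n (F * G) m = conj k n F (conj k n G m) := by
  rw [conj_apply, conj_apply, conj_apply, ZBim.parity_parity, Module.End.mul_apply]

theorem d_mul_apply (F G : EndZ k n) (m : ZBim k n) :
    d k n (F * G) m = d k n F (G m) + conj k n F (d k n G m) := by
  rw [d_apply, d_apply, d_apply, conj_mul_apply, Module.End.mul_apply, map_sub]
  abel

theorem d_mul_of_mem {p : ZMod 2} {F : EndZ k n} (hF : F ∈ part k n p) (G : EndZ k n) :
    d k n (F * G) = d k n F * G + (-1 : ℤˣ) ^ p • (F * d k n G) := by
  ext m
  rw [d_mul_apply, conj_of_mem hF]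
  simp only [Units.smul_def]
  rfl

theorem d_parity (m : ZBim k n) : ZBim.d k n (ZBim.parity k n m) = -ZBim.parity k n (ZBim.d k n m) := by
  apply (ZBim.coeff k n).injective
  have hp : OPol.parity k n (ZBim.dz k n) = -ZBim.dz k n := by
    rw [OPol.parity_of_mem ZBim.dz_mem_part, uzpow_one, Units.neg_smul, one_smul]
  rw [map_neg, ZBim.coeff_d, ZBim.coeff_parity, ZBim.coeff_parity, ZBim.coeff_d, OPol.d_parity,
    map_add, map_mul, hp, OPol.parity_parity, mul_neg, neg_add, neg_neg]

theorem d_d (F : EndZ k n) : d k n (d k n F) = 0 := by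
  ext m
  have h : conj k n F (ZBim.parity k n m) = ZBim.parity k n (F m) := by
    rw [conj_apply, ZBim.parity_parity]
  rw [d_apply, conj_apply, d_apply, d_apply, map_sub, map_sub, ZBim.d_d, d_parity, map_neg, map_neg,
    conj_apply, conj_apply, ZBim.parity_parity, d_parity, ZBim.parity_parity, ZBim.d_d, map_zero]
  simp

theorem d_mem_part {p : ZMod 2} {F : EndZ k n} (hF : F ∈ part k n p) :
    d k n F ∈ part k n (p + 1) := by
  intro q m hm
  rw [d_of_mem hF]
  have h₁ := (ZBim.isDGBimodule k n).odd _ _ (hF q m hm)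
  have h₂ := hF _ _ ((ZBim.isDGBimodule k n).odd q m hm)
  rw [add_assoc, add_comm 1 p] at h₂
  rw [add_assoc] at h₁
  refine sub_mem h₁ ?_
  rw [Units.smul_def]
  exact zsmul_mem h₂ _

theorem leftMul_mem_part {p : ZMod 2} {f : OPol k n} (hf : f ∈ OPol.part k n p) :
    leftMul f ∈ part k n p := by
  intro q m hm
  have h := OPol.mul_mem_part hf (ZBim.mem_part_iff.1 hm)
  rwa [add_comm] at h

theorem crossing_mem_part (i : Fin (n - 1)) : crossing (k := k) i ∈ part k n 1 := by
  intro q m hm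
  rw [ZBim.mem_part_iff, coeff_crossing]
  exact OPol.divDiff_mem_part i hm

theorem d_leftMul (f : OPol k n) (hf : f ∈ OPol.part k n 1) :
    d k n (leftMul f) = leftMul (OPol.d k n f) := by
  ext m
  have h : conj k n (leftMul f) = -leftMul f := by
    rw [conj_of_mem (leftMul_mem_part hf), uzpow_one, Units.neg_smul, one_smul]
  have hp : OPol.parity k n f = -f := by
    rw [OPol.parity_of_mem hf, uzpow_one, Units.neg_smul, one_smul]
  rw [d_apply, h, LinearMap.neg_apply]
  change ZBim.d k n (f • m) - -(f • ZBim.d k n m) = OPol.d k n f • m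
  rw [ZBim.d_smul, hp, neg_smul]
  abel

/-- Of two neighbouring variables exactly one has coefficient `1` in `dz`, the other having `0`. -/
theorem divDiff_dz (i : Fin (n - 1)) : OPol.divDiff k n i (ZBim.dz k n) = 1 := by
  rw [ZBim.dz, map_sum]
  simp only [map_nsmul, OPol.divDiff_x]
  rw [Finset.sum_eq_add (lo i) (hi i) (lo_ne_hi i)]
  · rw [if_pos (Or.inl rfl), if_pos (Or.inr rfl), ← add_smul, coe_lo, coe_hi,
      bracket_add_bracket_succ, one_smul]
  · rintro j - ⟨h₁, h₂⟩
    simp [h₁, h₂]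
  · simp
  · simp

/-- On coefficients, `d ∂_i + ∂_i d` for the differential of `OPol_n` gives `f - s_i f`. The `dz`
terms contribute `s_i f * ∂_i dz = s_i f`, while the two products of `∂_i f` with `dz` cancel. -/
theorem d_crossing (i : Fin (n - 1)) : d k n (crossing (k := k) i) = 1 := by
  apply ext_coeff
  intro m
  rw [d_apply, conj_of_mem (crossing_mem_part i), uzpow_one, Units.neg_smul, one_smul,
    LinearMap.neg_apply, sub_neg_eq_add, map_add, coeff_crossing, ZBim.coeff_d, ZBim.coeff_d,
    coeff_crossing, map_add, OPol.divDiff_mul, divDiff_dz, OPol.divDiff_parity,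
    Module.End.one_apply]
  have h := OPol.d_divDiff (k := k) i (ZBim.coeff k n m)
  have hs : ∀ f : OPol k n, OPol.parity k n (OPol.perm k n (Equiv.swap (lo i) (hi i))
      (OPol.parity k n f)) = OPol.perm k n (Equiv.swap (lo i) (hi i)) f := by
    intro f
    have : ((OPol.parity k n).comp (OPol.perm k n (Equiv.swap (lo i) (hi i)))).comp
        (OPol.parity k n) = OPol.perm k n (Equiv.swap (lo i) (hi i)) :=
      OPol.algHom_ext (by simp)
    exact DFunLike.congr_fun this f
  rw [hs, mul_one, neg_mul]
  refine Eq.trans ?_ (eq_sub_iff_add_eq.1 h)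
  abel

end EndZ

/-! ### Generating skew polynomials over odd symmetric ones in bounded degree -/

namespace OPol

variable {k : Type*} [CommRing k] {n : ℕ}

variable (k n) in
/-- The skew polynomials of degree at most one. -/
def degreeLEOne : Submodule k (OPol k n) := 1 ⊔ Submodule.span k (Set.range (x k n))

theorem one_le_degreeLEOne : 1 ≤ degreeLEOne k n := le_sup_left

theorem x_mem_degreeLEOne (i : Fin n) : x k n i ∈ degreeLEOne k n :=
  Submodule.mem_sup_right (Submodule.subset_span ⟨i, rfl⟩)

theorem degreeLEOne_pow_mono {a b : ℕ} (h : a ≤ b) : degreeLEOne k n ^ a ≤ degreeLEOne k n ^ b :=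
  pow_le_pow_right₀ one_le_degreeLEOne h

variable (k n) in
/-- The subalgebra generated by the first `j` variables. -/
def initial (j : ℕ) : Subalgebra k (OPol k n) :=
  Algebra.adjoin k {a | ∃ i : Fin n, (i : ℕ) < j ∧ x k n i = a}

theorem x_mem_initial {j : ℕ} {i : Fin n} (h : (i : ℕ) < j) : x k n i ∈ initial k n j :=
  Algebra.subset_adjoin ⟨i, h, rfl⟩

theorem initial_mono {j l : ℕ} (h : j ≤ l) : initial k n j ≤ initial k n l :=
  Algebra.adjoin_mono fun _ ⟨i, hi, e⟩ => ⟨i, hi.trans_le h, e⟩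

/-- Passing `x_j` only changes the signs of the earlier variables, so it normalizes the subalgebra
they generate. -/
theorem exists_x_mul_eq (j : Fin n) {p : OPol k n} (hp : p ∈ initial k n j) :
    ∃ p' ∈ initial k n j, x k n j * p = p' * x k n j := by
  induction hp using Algebra.adjoin_induction with
  | mem a ha =>
    obtain ⟨i, hi, rfl⟩ := ha
    refine ⟨-x k n i, neg_mem (x_mem_initial hi), ?_⟩
    rw [neg_mul, x_mul_x]
    rintro rfl
    exact lt_irrefl _ hi
  | algebraMap r => exact ⟨_, Subalgebra.algebraMap_mem _ r, (Algebra.commutes r _).symm⟩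
  | add a b _ _ ha hb =>
    obtain ⟨a', ha', ea⟩ := ha
    obtain ⟨b', hb', eb⟩ := hb
    exact ⟨a' + b', add_mem ha' hb', by rw [mul_add, ea, eb, add_mul]⟩
  | mul a b _ _ ha hb =>
    obtain ⟨a', ha', ea⟩ := ha
    obtain ⟨b', hb', eb⟩ := hb
    exact ⟨a' * b', mul_mem ha' hb', by rw [← mul_assoc, ea, mul_assoc, eb, mul_assoc]⟩

theorem exists_x_pow_mul_eq (j : Fin n) (m : ℕ) {p : OPol k n} (hp : p ∈ initial k n j) :
    ∃ p' ∈ initial k n j, x k n j ^ m * p = p' * x k n j ^ m := by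
  induction m with
  | zero => exact ⟨p, hp, by simp⟩
  | succ m ih =>
    obtain ⟨p', hp', e⟩ := ih
    obtain ⟨p'', hp'', e'⟩ := exists_x_mul_eq j hp'
    exact ⟨p'', hp'', by rw [pow_succ', mul_assoc, e, ← mul_assoc, e', mul_assoc]⟩

theorem x_mul_x_pow {i j : Fin n} (h : i ≠ j) (m : ℕ) :
    x k n i * x k n j ^ m = x k n j ^ m * ((-1 : k) ^ m • x k n i) := by
  induction m with
  | zero => simp
  | succ m ih =>
    rw [pow_succ, ← mul_assoc, ih, mul_assoc, smul_mul_assoc, x_mul_x h, pow_succ, mul_assoc]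
    simp

variable (k n) in
/-- The module `Q_j OΛ_n`, for `Q_j` the subalgebra generated by the first `j` variables. -/
def initialMul (j : ℕ) : Submodule k (OPol k n) :=
  Subalgebra.toSubmodule (initial k n j) * Subalgebra.toSubmodule (OSym k n)

theorem mul_mem_initialMul {j : ℕ} {p s : OPol k n} (hp : p ∈ initial k n j)
    (hs : s ∈ OSym k n) : p * s ∈ initialMul k n j :=
  Submodule.mul_mem_mul (M := Subalgebra.toSubmodule (initial k n j)) hp hs

theorem one_mem_initialMul (j : ℕ) : 1 ∈ initialMul k n j := by
  rw [← one_mul (1 : OPol k n)]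
  exact mul_mem_initialMul (one_mem _) (one_mem _)

theorem initialMul_mono {j l : ℕ} (h : j ≤ l) : initialMul k n j ≤ initialMul k n l :=
  mul_le_mul' (initial_mono h) le_rfl

theorem initial_mul_mem_initialMul {j : ℕ} {p a : OPol k n} (hp : p ∈ initial k n j)
    (ha : a ∈ initialMul k n j) : p * a ∈ initialMul k n j := by
  induction ha using Submodule.mul_induction_on' with
  | mem_mul_mem q hq s hs =>
    rw [← mul_assoc]
    exact mul_mem_initialMul (mul_mem hp hq) hs
  | add a _ b _ ha hb => rw [mul_add]; exact add_mem ha hb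

theorem initialMul_mul_mem {j : ℕ} {a s : OPol k n} (ha : a ∈ initialMul k n j)
    (hs : s ∈ OSym k n) : a * s ∈ initialMul k n j := by
  induction ha using Submodule.mul_induction_on' with
  | mem_mul_mem q hq t ht =>
    rw [mul_assoc]
    exact mul_mem_initialMul hq (mul_mem ht hs)
  | add a _ b _ ha hb => rw [add_mul]; exact add_mem ha hb

/-- The recursion that splits off `x_j` is solved for the shorter tail, starting from the full
elementary polynomials in `OΛ_n`. -/
theorem tailEsymm_mem_initialMul {j : ℕ} (hj : j ≤ n) (m : ℕ) :
    tailEsymm k n j m ∈ initialMul k n j := by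
  induction j generalizing m with
  | zero =>
    rw [tailEsymm_zero_left, ← one_mul (esymm k n m)]
    exact mul_mem_initialMul (one_mem _) (esymm_mem m)
  | succ j ih =>
    induction m with
    | zero =>
      rw [tailEsymm_zero]
      exact one_mem_initialMul _
    | succ m ihm =>
      have e := tailEsymm_succ (k := k) (⟨j, hj⟩ : Fin n) m
      change tailEsymm k n j (m + 1) = tailEsymm k n (j + 1) (m + 1) + _ at e
      rw [← sub_eq_iff_eq_add.2 e]
      refine sub_mem (initialMul_mono (Nat.le_succ j) (ih (Nat.le_of_succ_le hj) _)) ?_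
      exact initial_mul_mem_initialMul (x_mem_initial (Nat.lt_succ_self j)) ihm

/-- The span of the powers of `x_j` with exponent below `m`. -/
def powers (j : Fin n) (m : ℕ) : Submodule k (OPol k n) :=
  Submodule.span k {a | ∃ i < m, x k n j ^ i = a}

theorem pow_mem_powers (j : Fin n) {i m : ℕ} (h : i < m) : x k n j ^ i ∈ powers (k := k) j m :=
  Submodule.subset_span ⟨i, h, rfl⟩

theorem powers_le (j : Fin n) (m : ℕ) : powers (k := k) j (m + 1) ≤ degreeLEOne k n ^ m := by
  refine Submodule.span_le.2 ?_
  rintro _ ⟨i, hi, rfl⟩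
  exact degreeLEOne_pow_mono (Nat.le_of_lt_succ hi)
    (Submodule.pow_mem_pow _ (x_mem_degreeLEOne j) i)

theorem x_mul_mem_powers (j : Fin n) {m : ℕ} {a : OPol k n} {Q : Submodule k (OPol k n)}
    (ha : a ∈ powers j m * Q) : x k n j * a ∈ powers j (m + 1) * Q := by
  induction ha using Submodule.mul_induction_on' with
  | mem_mul_mem v hv q hq =>
    rw [← mul_assoc]
    refine Submodule.mul_mem_mul ?_ hq
    induction hv using Submodule.span_induction with
    | mem v hv =>
      obtain ⟨i, hi, rfl⟩ := hv
      rw [← pow_succ']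
      exact pow_mem_powers j (Nat.succ_lt_succ hi)
    | zero => rw [mul_zero]; exact zero_mem _
    | add a b _ _ ha hb => rw [mul_add]; exact add_mem ha hb
    | smul r a _ ha => rw [mul_smul_comm]; exact Submodule.smul_mem _ _ ha
  | add a _ b _ ha hb => rw [mul_add]; exact add_mem ha hb

/-- Iterating `e_{m+1}(x_{>j}) = e_{m+1}(x_{≥j}) - x_j e_m(x_{>j})` expands `e_m(x_{>j})` in powers
of `x_j` with leading term `(-x_j)^m` and lower coefficients in `Q_j OΛ_n`. -/
theorem tailEsymm_sub_pow_mem (j : Fin n) (m : ℕ) :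
    tailEsymm k n (j + 1) m - (-x k n j) ^ m ∈ powers j m * initialMul k n j := by
  induction m with
  | zero => rw [tailEsymm_zero, pow_zero, sub_self]; exact zero_mem _
  | succ m ih =>
    have e : tailEsymm k n (j + 1) (m + 1) - (-x k n j) ^ (m + 1) = 1 * tailEsymm k n j (m + 1) -
        x k n j * (tailEsymm k n (j + 1) m - (-x k n j) ^ m) := by
      rw [tailEsymm_succ, pow_succ', mul_sub, neg_mul]
      noncomm_ring
    rw [e]
    refine sub_mem (Submodule.mul_mem_mul ?_ (tailEsymm_mem_initialMul j.2.le _))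
      (x_mul_mem_powers j ih)
    have h := pow_mem_powers (k := k) j (Nat.succ_pos m)
    rwa [pow_zero] at h

/-- Counting indices from `0`, only `n - j - 1` variables follow `x_j`, so their elementary
polynomial of degree `n - j` vanishes. The expansion of `tailEsymm_sub_pow_mem` thus becomes a monic
relation of degree `n - j` for `x_j`. -/
theorem pow_mem_powers_mul (j : Fin n) :
    x k n j ^ (n - j) ∈ powers j (n - j) * initialMul k n j := by
  have h := tailEsymm_sub_pow_mem (k := k) j (n - j)
  rw [tailEsymm_eq_zero (by omega) (by omega), zero_sub, neg_pow, ← neg_mul] at h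
  have h' := Submodule.smul_mem _ (-(-1 : k) ^ (n - (j : ℕ))) h
  have e : (-(-1 : k) ^ (n - (j : ℕ))) • (-(-1 : OPol k n) ^ (n - (j : ℕ)) * x k n j ^ (n - (j : ℕ))) =
      x k n j ^ (n - (j : ℕ)) := by
    rcases Nat.even_or_odd (n - (j : ℕ)) with h | h
    · simp [h.neg_one_pow]
    · simp [h.neg_one_pow]
  rwa [e] at h'

theorem initial_mul_mem (j : Fin n) {p a : OPol k n} (hp : p ∈ initial k n j)
    (ha : a ∈ powers j (n - j) * initialMul k n j) :
    p * a ∈ powers j (n - j) * initialMul k n j := by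
  induction hp using Algebra.adjoin_induction generalizing a with
  | mem p hp =>
    obtain ⟨i, hi, rfl⟩ := hp
    have hij : i ≠ j := by rintro rfl; exact lt_irrefl _ hi
    induction ha using Submodule.mul_induction_on' with
    | mem_mul_mem v hv q hq =>
      have hq' : x k n i * q ∈ initialMul k n j := initial_mul_mem_initialMul (x_mem_initial hi) hq
      induction hv using Submodule.span_induction with
      | mem v hv =>
        obtain ⟨l, hl, rfl⟩ := hv
        rw [← mul_assoc, x_mul_x_pow hij, mul_assoc, smul_mul_assoc]
        exact Submodule.mul_mem_mul (pow_mem_powers j hl) (Submodule.smul_mem _ _ hq')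
      | zero => rw [zero_mul, mul_zero]; exact zero_mem _
      | add a b _ _ ha hb => rw [add_mul, mul_add]; exact add_mem ha hb
      | smul r a _ ha =>
        rw [smul_mul_assoc, mul_smul_comm]; exact Submodule.smul_mem _ _ ha
    | add a _ b _ ha hb => rw [mul_add]; exact add_mem ha hb
  | algebraMap r =>
    rw [← Algebra.smul_def]
    exact Submodule.smul_mem _ _ ha
  | add p q _ _ hp hq => rw [add_mul]; exact add_mem (hp ha) (hq ha)
  | mul p q _ _ hp hq => rw [mul_assoc]; exact hp (hq ha)

theorem mul_OSym_mem {Q : Submodule k (OPol k n)} {j : ℕ} {a s : OPol k n}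
    (ha : a ∈ Q * initialMul k n j) (hs : s ∈ OSym k n) : a * s ∈ Q * initialMul k n j := by
  induction ha using Submodule.mul_induction_on' with
  | mem_mul_mem v hv q hq =>
    rw [mul_assoc]
    exact Submodule.mul_mem_mul hv (initialMul_mul_mem hq hs)
  | add a _ b _ ha hb => rw [add_mul]; exact add_mem ha hb

theorem x_mul_mem (j : Fin n) {a : OPol k n} (ha : a ∈ powers j (n - j) * initialMul k n j) :
    x k n j * a ∈ powers j (n - j) * initialMul k n j := by
  induction ha using Submodule.mul_induction_on' with
  | mem_mul_mem v hv q hq =>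
    induction hv using Submodule.span_induction with
    | mem v hv =>
      obtain ⟨i, hi, rfl⟩ := hv
      rw [← mul_assoc, ← pow_succ']
      rcases Nat.lt_or_ge (i + 1) (n - j) with hi' | hi'
      · exact Submodule.mul_mem_mul (pow_mem_powers j hi') hq
      -- The top power is reached. It is first carried to the right of the coefficient from `Q_j`,
      -- then reduced by the monic relation next to `OΛ_n`.
      · rw [show i + 1 = n - (j : ℕ) from le_antisymm hi hi']
        induction hq using Submodule.mul_induction_on' with
        | mem_mul_mem p hp s hs =>
          obtain ⟨p', hp', e⟩ := exists_x_pow_mul_eq j (n - j) hp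
          rw [← mul_assoc, e]
          exact mul_OSym_mem (initial_mul_mem j hp' (pow_mem_powers_mul j)) hs
        | add a _ b _ ha hb => rw [mul_add]; exact add_mem ha hb
    | zero => rw [zero_mul, mul_zero]; exact zero_mem _
    | add a b _ _ ha hb => rw [add_mul, mul_add]; exact add_mem ha hb
    | smul r a _ ha => rw [smul_mul_assoc, mul_smul_comm]; exact Submodule.smul_mem _ _ ha
  | add a _ b _ ha hb => rw [mul_add]; exact add_mem ha hb

/-- The space spanned by `x_j^i Q_j OΛ_n` with `i < n - j` contains `1` and is stable under left
multiplication by the first `j + 1` variables, hence contains `Q_{j+1} OΛ_n`. -/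
theorem initialMul_succ_le (j : Fin n) :
    initialMul k n (j + 1) ≤ degreeLEOne k n ^ (n - 1 - j) * initialMul k n j := by
  have hone : (1 : OPol k n) ∈ powers j (n - j) * initialMul k n j := by
    have h := pow_mem_powers (k := k) j (show 0 < n - (j : ℕ) by omega)
    rw [pow_zero] at h
    rw [← one_mul (1 : OPol k n)]
    exact Submodule.mul_mem_mul h (one_mem_initialMul _)
  have hmul : ∀ p ∈ initial k n (j + 1), ∀ a ∈ powers j (n - j) * initialMul k n j,
      p * a ∈ powers j (n - j) * initialMul k n j := by
    intro p hp
    induction hp using Algebra.adjoin_induction with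
    | mem p hp =>
      obtain ⟨i, hi, rfl⟩ := hp
      intro a ha
      rcases Nat.lt_succ_iff_lt_or_eq.1 hi with hi | hi
      · exact initial_mul_mem j (x_mem_initial hi) ha
      · rw [Fin.ext hi]
        exact x_mul_mem j ha
    | algebraMap r =>
      intro a ha
      rw [← Algebra.smul_def]
      exact Submodule.smul_mem _ _ ha
    | add p q _ _ hp hq => intro a ha; rw [add_mul]; exact add_mem (hp a ha) (hq a ha)
    | mul p q _ _ hp hq => intro a ha; rw [mul_assoc]; exact hp _ (hq a ha)
  have hle : powers (k := k) j (n - j) ≤ degreeLEOne k n ^ (n - 1 - j) := by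
    have e : n - (j : ℕ) = n - 1 - j + 1 := by omega
    rw [e]
    exact powers_le j _
  refine Submodule.mul_le.2 fun p hp s hs => mul_le_mul' hle le_rfl ?_
  have h := hmul p hp 1 hone
  rw [mul_one] at h
  exact mul_OSym_mem h hs

theorem initialMul_le {j : ℕ} (hj : j ≤ n) :
    initialMul k n j ≤ degreeLEOne k n ^ (∑ i ∈ Finset.range j, (n - 1 - i)) *
      Subalgebra.toSubmodule (OSym k n) := by
  induction j with
  | zero =>
    rw [Finset.range_zero, Finset.sum_empty, pow_zero, initialMul]
    refine mul_le_mul' ?_ le_rfl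
    have h : initial k n 0 = ⊥ := by
      rw [initial, ← Algebra.adjoin_empty]
      congr 1
      ext a
      simp
    rw [h, Algebra.toSubmodule_bot]
  | succ j ih =>
    refine (initialMul_succ_le (⟨j, hj⟩ : Fin n)).trans ?_
    rw [Finset.sum_range_succ, add_comm, pow_add, mul_assoc]
    exact mul_le_mul' le_rfl (ih (Nat.le_of_succ_le hj))

variable (k n) in
/-- Skew polynomials are spanned, over the odd symmetric polynomials, by polynomials of degree at
most `n (n - 1) / 2`. -/
theorem degreeLEOne_pow_mul_OSym :
    degreeLEOne k n ^ (∑ i ∈ Finset.range n, i) * Subalgebra.toSubmodule (OSym k n) = ⊤ := by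
  -- Eliminating `x_j` costs degree `n - 1 - j`; reversing the sum yields these exponents.
  rw [eq_top_iff, ← Finset.sum_range_reflect (fun i => i)]
  refine le_trans ?_ (initialMul_le le_rfl)
  intro a _
  have ha : a ∈ initial k n n := by
    induction a using gen_induction with
    | one => exact one_mem _
    | add a b ha hb => exact add_mem (ha trivial) (hb trivial)
    | smul r a ha => exact Subalgebra.smul_mem _ (ha trivial) r
    | x_mul i a ha => exact mul_mem (x_mem_initial i.2) (ha trivial)
  rw [← mul_one a]
  exact mul_mem_initialMul ha (one_mem _)

theorem monomialMap_degreeLEOne_pow (c : Fin n → k) (w : Equiv.Perm (Fin n)) (d : ℕ) {a : OPol k n}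
    (ha : a ∈ degreeLEOne k n ^ d) : monomialMap c w a ∈ degreeLEOne k n ^ d := by
  have h : (degreeLEOne k n).map (monomialMap c w).toLinearMap ≤ degreeLEOne k n := by
    rw [degreeLEOne, Submodule.map_sup]
    refine sup_le ?_ ?_
    · rw [Submodule.map_one]
      exact le_sup_left
    · rw [Submodule.map_span, Submodule.span_le]
      rintro _ ⟨_, ⟨i, rfl⟩, rfl⟩
      rw [AlgHom.toLinearMap_apply, monomialMap, lift_x]
      exact Submodule.smul_mem _ _ (x_mem_degreeLEOne _)
  have h' : monomialMap c w a ∈ ((degreeLEOne k n) ^ d).map (monomialMap c w).toLinearMap :=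
    ⟨a, ha, rfl⟩
  rw [Submodule.map_pow] at h'
  exact pow_le_pow_left' h d h'

theorem thetaW0_surjective : Function.Surjective (thetaW0 k n) := by
  intro a
  change a ∈ (thetaW0 k n).range
  induction a using gen_induction with
  | one => exact one_mem _
  | add a b ha hb => exact add_mem ha hb
  | smul r a ha => exact Subalgebra.smul_mem _ ha r
  | x_mul i a ha =>
    refine mul_mem ⟨(-1 : k) ^ (i : ℕ) • x k n i.rev, ?_⟩ ha
    change thetaW0 k n ((-1 : k) ^ (i : ℕ) • x k n i.rev) = x k n i
    rw [map_smul, thetaW0_x, Fin.rev_rev, smul_smul, ← pow_add, ← two_mul, pow_mul]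
    simp

/-- The twisted odd symmetric polynomials, through which the right action on `Z_n` is given. -/
def twistedOSym (k : Type*) [CommRing k] (n : ℕ) : Submodule k (OPol k n) :=
  (Subalgebra.toSubmodule (OSym k n)).map (thetaW0 k n).toLinearMap

theorem degreeLEOne_pow_mul_twistedOSym :
    degreeLEOne k n ^ (∑ i ∈ Finset.range n, i) * twistedOSym k n = ⊤ := by
  have h := congrArg (Submodule.map (thetaW0 k n).toLinearMap) (degreeLEOne_pow_mul_OSym k n)
  rw [Submodule.map_mul, Submodule.map_top, LinearMap.range_eq_top.2 thetaW0_surjective] at h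
  rw [eq_top_iff, ← h]
  refine mul_le_mul' ?_ le_rfl
  rintro _ ⟨a, ha, rfl⟩
  exact monomialMap_degreeLEOne_pow _ _ _ (monomialMap_degreeLEOne_pow _ _ _ ha)

/-- `∂_i` sends polynomials of degree at most one to constants, and `s_i` and the parity involution
preserve the degree filtration, so the twisted Leibniz rule gives the drop by one in general. -/
theorem divDiff_degreeLEOne_pow (i : Fin (n - 1)) (d : ℕ) {a : OPol k n}
    (ha : a ∈ degreeLEOne k n ^ (d + 1)) : divDiff k n i a ∈ degreeLEOne k n ^ d := by
  have h₁ : ∀ w ∈ degreeLEOne k n, divDiff k n i w ∈ (1 : Submodule k (OPol k n)) := by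
    intro w hw
    obtain ⟨u, hu, v, hv, rfl⟩ := Submodule.mem_sup.1 hw
    rw [map_add]
    refine add_mem ?_ ?_
    · obtain ⟨r, rfl⟩ := Submodule.mem_one.1 hu
      rw [Algebra.algebraMap_eq_smul_one, map_smul, divDiff_one, smul_zero]
      exact zero_mem _
    · clear hw
      induction hv using Submodule.span_induction with
      | mem v hv =>
        obtain ⟨j, rfl⟩ := hv
        rw [divDiff_x]
        split_ifs
        · exact Submodule.one_le.1 le_rfl
        · exact zero_mem _
      | zero => rw [map_zero]; exact zero_mem _
      | add a b _ _ ha hb =>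
        rw [map_add]
        exact add_mem ha hb
      | smul r a _ ha => rw [map_smul]; exact Submodule.smul_mem _ _ ha
  induction d generalizing a with
  | zero =>
    rw [zero_add, pow_one] at ha
    rw [pow_zero]
    exact h₁ a ha
  | succ d ih =>
    rw [pow_succ'] at ha
    induction ha using Submodule.mul_induction_on' with
    | mem_mul_mem w hw f hf =>
      rw [divDiff_mul]
      refine add_mem ?_ ?_
      · have h := Submodule.mul_mem_mul (h₁ w hw) hf
        rwa [one_mul] at h
      · rw [pow_succ']
        refine Submodule.mul_mem_mul ?_ (ih hf)
        have hw' : w ∈ degreeLEOne k n ^ 1 := by rwa [pow_one]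
        have h := monomialMap_degreeLEOne_pow (fun _ => -1) (Equiv.refl _) 1
          (monomialMap_degreeLEOne_pow (fun _ => 1) (Equiv.swap (lo i) (hi i)) 1 hw')
        rwa [pow_one] at h
    | add a _ b _ ha hb => rw [map_add]; exact add_mem ha hb

end OPol

/-- Equality up to sign. -/
def EqUpToSign {A : Type*} [Neg A] (a b : A) : Prop := a = b ∨ a = -b

/-! ### Identities up to sign, enough for vanishing and ideal membership -/

namespace EqUpToSign

variable {A : Type*} [Ring A] {a b c : A}

theorem trans (h : EqUpToSign a b) (h' : EqUpToSign b c) : EqUpToSign a c := by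
  rcases h with rfl | rfl <;> rcases h' with rfl | rfl <;> simp [EqUpToSign]

theorem symm (h : EqUpToSign a b) : EqUpToSign b a := by
  rcases h with rfl | rfl <;> simp [EqUpToSign]

theorem of_eq (h : a = b) : EqUpToSign a b := Or.inl h

theorem mul_left (c : A) (h : EqUpToSign a b) : EqUpToSign (c * a) (c * b) := by
  rcases h with rfl | rfl <;> simp [EqUpToSign]

theorem mul_right (c : A) (h : EqUpToSign a b) : EqUpToSign (a * c) (b * c) := by
  rcases h with rfl | rfl <;> simp [EqUpToSign]

theorem neg_left (h : EqUpToSign a b) : EqUpToSign (-a) b := by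
  rcases h with rfl | rfl <;> simp [EqUpToSign]

theorem eq_zero (h : EqUpToSign a b) (hb : b = 0) : a = 0 := by
  rcases h with rfl | rfl <;> simp [hb]

theorem mul_comm_mul (ha : EqUpToSign (a * c) (c * a)) (hb : EqUpToSign (b * c) (c * b)) :
    EqUpToSign (a * b * c) (c * (a * b)) := by
  rw [mul_assoc, ← mul_assoc c]
  refine (hb.mul_left a).trans ?_
  rw [← mul_assoc]
  exact ha.mul_right b

end EqUpToSign

/-! ### The longest crossing and the ideal it generates -/

namespace ONH

variable (k : Type*) [CommRing k] (n : ℕ)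

/-- The dot on strand `i`, or zero if there is no such strand. -/
def dot (i : ℕ) : ONH k n := if h : i < n then x k n ⟨i, h⟩ else 0

/-- The crossing of strands `i` and `i + 1`, or zero if there are no such strands. -/
def cross (i : ℕ) : ONH k n := if h : i < n - 1 then del k n ⟨i, h⟩ else 0

variable {k n}

theorem cross_mul_self (i : ℕ) : cross k n i * cross k n i = 0 := by
  unfold cross
  split_ifs
  · exact cross_sq _
  · exact mul_zero _

theorem cross_far {i j : ℕ} (h : i + 1 < j ∨ j + 1 < i) :
    EqUpToSign (cross k n i * cross k n j) (cross k n j * cross k n i) := by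
  unfold cross
  split_ifs with hi hj
  · exact Or.inr (eq_neg_of_add_eq_zero_left (cross_cross h))
  all_goals simp [EqUpToSign]

theorem cross_braid (i : ℕ) : cross k n i * cross k n (i + 1) * cross k n i =
    cross k n (i + 1) * cross k n i * cross k n (i + 1) := by
  unfold cross
  split_ifs with hi hj
  · exact braid rfl
  all_goals simp

theorem cross_mul_dot {i j : ℕ} (h₁ : j ≠ i) (h₂ : j ≠ i + 1) :
    EqUpToSign (cross k n i * dot k n j) (dot k n j * cross k n i) := by
  unfold cross dot
  split_ifs with hi hj
  · refine Or.inr (eq_neg_of_add_eq_zero_left (cross_dot ?_ ?_)) <;>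
      simpa [Fin.ext_iff, coe_lo, coe_hi]
  all_goals simp [EqUpToSign]

/-- This relation has a constant term, so unlike the preceding ones it does not survive the default
value zero for missing strands. -/
theorem cross_mul_dot_self {i : ℕ} (h : i + 1 < n) :
    cross k n i * dot k n i = 1 - dot k n (i + 1) * cross k n i := by
  rw [eq_sub_iff_add_eq]
  unfold cross dot
  rw [dif_pos (by omega), dif_pos h, dif_pos (by omega)]
  exact slide_right (⟨i, by omega⟩ : Fin (n - 1))

variable (k n) in
/-- The product `∂_{j+t-1} ⋯ ∂_j`. -/
def chain : ℕ → ℕ → ONH k n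
  | _, 0 => 1
  | j, t + 1 => chain (j + 1) t * cross k n j

theorem chain_zero (j : ℕ) : chain k n j 0 = 1 := by rw [chain]

theorem chain_succ (j t : ℕ) : chain k n j (t + 1) = chain k n (j + 1) t * cross k n j := by
  rw [chain]

theorem chain_add (j s t : ℕ) :
    chain k n j (s + t) = chain k n (j + s) t * chain k n j s := by
  induction s generalizing j with
  | zero => rw [chain_zero, mul_one, zero_add, add_zero]
  | succ s ih =>
    rw [chain_succ, ← mul_assoc, add_right_comm s 1 t, chain_succ, ih, add_assoc, add_comm 1 s]

theorem chain_succ' (j t : ℕ) : chain k n j (t + 1) = cross k n (j + t) * chain k n j t := by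
  rw [chain_add, chain_succ, chain_zero, one_mul]

theorem chain_comm_cross {i j t : ℕ} (h : i + 1 < j ∨ j + t < i) :
    EqUpToSign (chain k n j t * cross k n i) (cross k n i * chain k n j t) := by
  induction t generalizing j with
  | zero => exact .of_eq (by rw [chain_zero, one_mul, mul_one])
  | succ t ih =>
    rw [chain_succ]
    exact .mul_comm_mul (ih (by omega)) (cross_far (by omega))

theorem chain_comm_dot {l j t : ℕ} (h : j + t < l) :
    EqUpToSign (chain k n j t * dot k n l) (dot k n l * chain k n j t) := by
  induction t generalizing j with
  | zero => exact .of_eq (by rw [chain_zero, one_mul, mul_one])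
  | succ t ih =>
    rw [chain_succ]
    exact .mul_comm_mul (ih (by omega)) (cross_mul_dot (by omega) (by omega))

/-- `∂_{i+1}` anticommutes past the factors below `∂_i`, the braid relation turns `∂_{i+1} ∂_i
∂_{i+1}` into `∂_i ∂_{i+1} ∂_i`, and the left `∂_i` anticommutes past the factors above `∂_{i+1}`.
-/
theorem chain_mul_cross {i j t : ℕ} (h₁ : j ≤ i) (h₂ : i + 2 ≤ j + t) :
    EqUpToSign (chain k n j t * cross k n (i + 1)) (cross k n i * chain k n j t) := by
  obtain ⟨a, rfl⟩ := Nat.exists_eq_add_of_le h₁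
  obtain ⟨b, rfl⟩ : ∃ b, t = a + (b + 2) := ⟨t - a - 2, by omega⟩
  rw [chain_add, chain_succ, chain_succ]
  have e₁ : EqUpToSign (chain k n j a * cross k n (j + a + 1))
      (cross k n (j + a + 1) * chain k n j a) := chain_comm_cross (by omega)
  have e₂ : EqUpToSign (chain k n (j + a + 1 + 1) b * cross k n (j + a))
      (cross k n (j + a) * chain k n (j + a + 1 + 1) b) := chain_comm_cross (by omega)
  rw [mul_assoc]
  refine (e₁.mul_left _).trans ?_
  have hb := cross_braid (k := k) (n := n) (j + a)
  have e₃ : chain k n (j + a + 1 + 1) b * cross k n (j + a + 1) * cross k n (j + a) *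
      (cross k n (j + a + 1) * chain k n j a) = chain k n (j + a + 1 + 1) b * cross k n (j + a) *
        (cross k n (j + a + 1) * cross k n (j + a) * chain k n j a) := by
    have := congrArg (fun c => chain k n (j + a + 1 + 1) b * c * chain k n j a) hb
    simp only [mul_assoc] at this ⊢
    exact this.symm
  rw [e₃]
  refine (e₂.mul_right _).trans (.of_eq ?_)
  simp only [mul_assoc]

theorem chain_mul_cross_zero (t : ℕ) : chain k n 0 (t + 1) * cross k n 0 = 0 := by
  rw [chain_succ, mul_assoc, cross_mul_self, mul_zero]

/-- Each factor of the second chain, taken from its left end, slides through the first with its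
index lowered by one, until the last, `∂_0`, meets the `∂_0` at the end of the first chain. -/
theorem chain_mul_chain {m s : ℕ} (h : s + 1 ≤ m) :
    chain k n 0 m * chain k n 0 (s + 1) = 0 := by
  induction s with
  | zero =>
    obtain ⟨t, rfl⟩ : ∃ t, m = t + 1 := ⟨m - 1, by omega⟩
    rw [zero_add, chain_succ 0 0, chain_zero, one_mul, chain_mul_cross_zero]
  | succ s ih =>
    rw [chain_succ', zero_add, ← mul_assoc]
    have e : EqUpToSign (chain k n 0 m * cross k n (s + 1)) (cross k n s * chain k n 0 m) :=
      chain_mul_cross (Nat.zero_le s) (by omega)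
    refine (e.mul_right _).eq_zero ?_
    rw [mul_assoc, ih (by omega), mul_zero]

variable (k n) in
/-- The crossing of the first `m` strands along the longest permutation. -/
def longest : ℕ → ONH k n
  | 0 => 1
  | m + 1 => longest m * chain k n 0 m

theorem longest_zero : longest k n 0 = 1 := by rw [longest]

theorem longest_succ (m : ℕ) : longest k n (m + 1) = longest k n m * chain k n 0 m := by
  rw [longest]

theorem longest_comm_cross {m i : ℕ} (h : m ≤ i) :
    EqUpToSign (longest k n m * cross k n i) (cross k n i * longest k n m) := by
  induction m with
  | zero => exact .of_eq (by rw [longest_zero, one_mul, mul_one])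
  | succ m ih =>
    rw [longest_succ]
    exact .mul_comm_mul (ih (by omega)) (chain_comm_cross (by omega))

theorem longest_comm_dot {m l : ℕ} (h : m ≤ l) :
    EqUpToSign (longest k n m * dot k n l) (dot k n l * longest k n m) := by
  induction m with
  | zero => exact .of_eq (by rw [longest_zero, one_mul, mul_one])
  | succ m ih =>
    rw [longest_succ]
    exact .mul_comm_mul (ih (by omega)) (chain_comm_dot (by omega))

/-- A crossing slides through the last chain to the next lower index and is absorbed by the shorter
longest crossing; `∂_0` dies in the chain itself. -/
theorem longest_mul_cross {m i : ℕ} (h : i + 1 < m) : longest k n m * cross k n i = 0 := by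
  induction m generalizing i with
  | zero => omega
  | succ m ih =>
    rw [longest_succ, mul_assoc]
    cases i with
    | zero =>
      obtain ⟨t, rfl⟩ : ∃ t, m = t + 1 := ⟨m - 1, by omega⟩
      rw [chain_mul_cross_zero, mul_zero]
    | succ i =>
      have e : EqUpToSign (chain k n 0 m * cross k n (i + 1)) (cross k n i * chain k n 0 m) :=
        chain_mul_cross (Nat.zero_le i) (by omega)
      refine (e.mul_left _).eq_zero ?_
      rw [← mul_assoc, ih (by omega), zero_mul]

/-- Only the top crossing `∂_i`, for `m = i + 2`, is new. It passes the longest crossing on `i`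
strands and lengthens the following chain, whose product with the last chain is zero by
`chain_mul_chain`. -/
theorem cross_mul_longest {m i : ℕ} (h : i + 1 < m) : cross k n i * longest k n m = 0 := by
  induction m with
  | zero => omega
  | succ m ih =>
    rw [longest_succ, ← mul_assoc]
    rcases Nat.lt_or_ge (i + 1) m with h' | h'
    · rw [ih h', zero_mul]
    · obtain rfl : m = i + 1 := by omega
      rw [longest_succ, ← mul_assoc]
      have e := (longest_comm_cross (k := k) (n := n) (le_refl i)).symm
      refine ((e.mul_right _).mul_right _).eq_zero ?_
      have hc := chain_succ' (k := k) (n := n) 0 i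
      rw [zero_add] at hc
      rw [mul_assoc (longest k n i), ← hc, mul_assoc, chain_mul_chain le_rfl, mul_zero]

/-- Moving `x_j` left through the chain by `∂_j x_j = 1 - x_{j+1} ∂_j` creates one correction term
per crossing. Only the first survives: in every later one a crossing from below the gap moves left
to `longest k n m`, which annihilates it. The dot itself arrives on strand `m` and passes to the far
left, giving `F`. -/
theorem longest_mul_chain_mul_dot {m j t : ℕ} (h : j + (t + 1) = m) (hm : m < n) :
    ∃ F, EqUpToSign F (dot k n m * (longest k n m * chain k n j (t + 1))) ∧
      longest k n m * chain k n j (t + 1) * dot k n j = longest k n m * chain k n (j + 1) t + F := by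
  induction t generalizing j with
  | zero =>
    obtain rfl : m = j + 1 := by omega
    refine ⟨-(longest k n (j + 1) * dot k n (j + 1) * cross k n j), ?_, ?_⟩
    · rw [chain_succ, chain_zero, one_mul, ← mul_assoc]
      exact ((longest_comm_dot le_rfl).mul_right _).neg_left
    · rw [chain_succ, chain_zero, one_mul, mul_one, mul_assoc, cross_mul_dot_self hm, mul_sub,
        mul_one, sub_eq_add_neg, mul_assoc]
  | succ t ih =>
    obtain ⟨F, hF, e⟩ := ih (j := j + 1) (by omega)
    refine ⟨-(F * cross k n j), ?_, ?_⟩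
    · rw [chain_succ j (t + 1), ← mul_assoc (longest k n m), ← mul_assoc]
      exact (hF.mul_right _).neg_left
    · have e₁ : longest k n m * chain k n (j + 1 + 1) t * cross k n j = 0 := by
        have h' : EqUpToSign (chain k n (j + 1 + 1) t * cross k n j)
            (cross k n j * chain k n (j + 1 + 1) t) := chain_comm_cross (by omega)
        rw [mul_assoc]
        refine (h'.mul_left _).eq_zero ?_
        rw [← mul_assoc, longest_mul_cross (by omega), zero_mul]
      rw [chain_succ j (t + 1), mul_assoc, mul_assoc, cross_mul_dot_self (by omega), mul_sub, mul_one,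
        mul_sub, ← mul_assoc (chain k n (j + 1) (t + 1)), ← mul_assoc (longest k n m),
        ← mul_assoc (longest k n m), e, add_mul, e₁, zero_add, sub_eq_add_neg]

/-- By `longest_mul_chain_mul_dot`, right multiplication by `x_j` deletes the last crossing of the
chain modulo a left multiple of what is already in `I`. After `m` deletions `longest k n (m + 1)`
has become `longest k n m`. -/
theorem longest_mem {I : TwoSidedIdeal (ONH k n)} (hI : longest k n n ∈ I) {m : ℕ} (h : m ≤ n) :
    longest k n m ∈ I := by
  induction h using Nat.decreasingInduction with
  | self => exact hI
  | of_succ m hm ih =>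
    rw [longest_succ] at ih
    have key : ∀ j t, j + t = m → longest k n m * chain k n j t ∈ I := by
      intro j
      induction j with
      | zero =>
        rintro t rfl
        rwa [zero_add] at ih ⊢
      | succ j ihj =>
        intro t ht
        have hjt := ihj (t + 1) (by omega)
        obtain ⟨F, hF, e⟩ := longest_mul_chain_mul_dot (k := k) (j := j) (t := t) (by omega) hm
        rw [← sub_eq_iff_eq_add.2 e]
        refine TwoSidedIdeal.sub_mem _ (I.mul_mem_right _ _ hjt) ?_
        rcases hF with rfl | rfl
        · exact I.mul_mem_left _ _ hjt
        · exact TwoSidedIdeal.neg_mem _ (I.mul_mem_left _ _ hjt)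
    have h := key m 0 rfl
    rwa [chain_zero, mul_one] at h

theorem one_mem_span_longest : (1 : ONH k n) ∈ TwoSidedIdeal.span {longest k n n} := by
  have h := longest_mem (k := k) (n := n) (I := TwoSidedIdeal.span {longest k n n})
    (TwoSidedIdeal.subset_span (Set.mem_singleton _)) (Nat.zero_le n)
  rwa [longest_zero] at h

/-- The odd nilHecke algebra is generated by its longest crossing as a two-sided ideal. -/
theorem ideal_induction {P : ONH k n → Prop} (mul : ∀ a b, P (a * longest k n n * b))
    (add : ∀ a b, P a → P b → P (a + b)) : P 1 := by
  have h : ∀ c ∈ TwoSidedIdeal.span {longest k n n}, ∀ a b, P (a * c * b) := by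
    intro c hc
    induction hc using TwoSidedIdeal.span_induction with
    | mem c hc => obtain rfl := hc; exact mul
    | zero =>
      intro a b
      have := mul 0 0
      simpa using this
    | add c c' _ _ h h' => intro a b; rw [mul_add, add_mul]; exact add _ _ (h a b) (h' a b)
    | neg c _ h => intro a b; have := h (-a) b; rwa [neg_mul, ← mul_neg] at this
    | left_absorb c' c _ h => intro a b; have := h (a * c') b; rwa [mul_assoc a] at this
    | right_absorb c' c _ h => intro a b; have := h a (c' * b); rwa [← mul_assoc, mul_assoc a] at this
  have := h 1 one_mem_span_longest 1 1
  simpa using this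

end ONH

/-! ### The action on `Z_n` and its bijectivity -/

namespace ONH

variable {k : Type*} [CommRing k] {n : ℕ}

/-- The universal property of the odd nilHecke algebra. -/
def lift {A : Type*} [Ring A] [Algebra k A] (f : ONHGen n → A)
    (hf : ∀ a b, ONHRel k n a b → FreeAlgebra.lift k f a = FreeAlgebra.lift k f b) :
    ONH k n →ₐ[k] A :=
  RingQuot.liftAlgHom k ⟨FreeAlgebra.lift k f, fun {a b} h => hf a b h⟩

theorem lift_gen {A : Type*} [Ring A] [Algebra k A] (f : ONHGen n → A)
    (hf : ∀ a b, ONHRel k n a b → FreeAlgebra.lift k f a = FreeAlgebra.lift k f b)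
    (g : ONHGen n) : lift f hf (gen k n g) = f g :=
  (RingQuot.liftAlgHom_mkAlgHom_apply k _ _ (FreeAlgebra.ι k g)).trans
    (FreeAlgebra.lift_ι_apply _ _)

theorem adjoin_gen : Algebra.adjoin k (Set.range (gen k n)) = ⊤ := by
  have h : Set.range (gen k n) = mk k n '' Set.range (FreeAlgebra.ι k) := by
    rw [← Set.range_comp]; rfl
  rw [h, ← AlgHom.map_adjoin, FreeAlgebra.adjoin_range_ι, Algebra.map_top, AlgHom.range_eq_top]
  exact RingQuot.mkAlgHom_surjective k (ONHRel k n)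

variable (k n) in
theorem iSup_part : ⨆ p, part k n p = ⊤ := iSup_wordPart adjoin_gen

theorem gen_induction {P : ONH k n → Prop} (one : P 1) (add : ∀ a b, P a → P b → P (a + b))
    (smul : ∀ (r : k) a, P a → P (r • a)) (gen_mul : ∀ g a, P a → P (gen k n g * a))
    (a : ONH k n) : P a :=
  word_induction (iSup_part k n) one add smul gen_mul a

/-- The homomorphism sending `a` to the matrix of multiplication by `a` on the even and odd parts,
which detects the parity. -/
def parityMatrix : ONH k n →ₐ[k] Matrix (Fin 2) (Fin 2) (ONH k n) :=
  lift (fun g => !![0, gen k n g; gen k n g, 0]) (by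
    intro a b h
    cases h with
    | dot_dot i j h =>
      have h' := dot_dot (k := k) h
      simp only [x] at h'
      ext a b
      fin_cases a <;> fin_cases b <;> simp [h']
    | cross_cross i j h =>
      have h' := cross_cross (k := k) h
      simp only [del] at h'
      ext a b
      fin_cases a <;> fin_cases b <;> simp [h']
    | cross_sq i =>
      have h' := cross_sq (k := k) i
      simp only [del] at h'
      ext a b
      fin_cases a <;> fin_cases b <;> simp [h']
    | braid i j h =>
      have h' := braid (k := k) h
      simp only [del] at h'
      ext a b
      fin_cases a <;> fin_cases b <;> simp [h']
    | cross_dot i j h₁ h₂ =>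
      have h' := cross_dot (k := k) h₁ h₂
      simp only [x, del] at h'
      ext a b
      fin_cases a <;> fin_cases b <;> simp [h']
    | slide_left i =>
      have h' := slide_left (k := k) i
      simp only [x, del] at h'
      ext a b
      fin_cases a <;> fin_cases b <;> simp [h']
    | slide_right i =>
      have h' := slide_right (k := k) i
      simp only [x, del] at h'
      ext a b
      fin_cases a <;> fin_cases b <;> simp [h'])

theorem parityMatrix_gen (g : ONHGen n) :
    parityMatrix (gen k n g) = !![0, gen k n g; gen k n g, 0] := lift_gen ..

theorem triang_lower (a : ONH k n) : triang k n a 1 0 = 0 ∧ triang k n a 1 1 = a := by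
  induction a using gen_induction with
  | one => simp
  | add a b ha hb => simp [ha, hb]
  | smul r a ha => simp [ha]
  | gen_mul g a ha => simp [Matrix.mul_apply, Fin.sum_univ_two, triang_gen, ha]

theorem d_one : d k n 1 = 0 := by
  change triang k n 1 0 1 = 0
  simp

theorem d_gen (g : ONHGen n) : d k n (gen k n g) = dGen g := by
  change triang k n (gen k n g) 0 1 = dGen g
  simp [triang_gen]

theorem d_gen_mul (g : ONHGen n) (a : ONH k n) :
    d k n (gen k n g * a) = d k n (gen k n g) * a - gen k n g * d k n a := by
  rw [d_gen]
  change triang k n (gen k n g * a) 0 1 = dGen g * a - gen k n g * triang k n a 0 1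
  rw [map_mul, Matrix.mul_apply, Fin.sum_univ_two, triang_gen, (triang_lower a).2]
  simp only [Matrix.of_apply, Matrix.cons_val', Matrix.cons_val_zero, Matrix.cons_val_one,
    neg_mul, sub_eq_add_neg]
  rw [add_comm]

variable (k n) in
theorem isDGAlgebra : IsDGAlgebra (part k n) (d k n) := by
  change IsDGAlgebra (wordPart k (gen k n)) (d k n)
  refine isDGAlgebra_wordPart (iSup_part k n) parityMatrix parityMatrix_gen (d k n) d_one d_gen_mul
    ?_ ?_
  · rintro (i | i)
    · rw [d_gen, dGen, pow_two]
      have h := mul_mem_wordPart (gen_mem_wordPart (k := k) (g := gen k n) (ONHGen.dot i))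
        (gen_mem_wordPart (ONHGen.dot i))
      rwa [CharTwo.add_self_eq_zero] at h
    · rw [d_gen, dGen]
      exact one_mem_wordPart
  · rintro (i | i)
    · rw [d_gen, dGen, pow_two, x, d_gen_mul, d_gen, dGen, x, pow_two, mul_assoc, sub_self]
    · rw [d_gen, dGen, d_one]

/-- The action of the generators on `Z_n`. -/
def actGen : ONHGen n → EndZ k n
  | ONHGen.dot i => EndZ.leftMul (OPol.x k n i)
  | ONHGen.cross i => EndZ.crossing i

variable (k n) in
/-- The action of the odd nilHecke algebra on `Z_n`. -/
def act : ONH k n →ₐ[k] EndZ k n :=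
  lift actGen (by
    intro a b h
    apply EndZ.ext_coeff
    intro m
    cases h with
    | dot_dot i j h =>
      simp only [map_add, map_mul, map_zero, FreeAlgebra.lift_ι_apply, actGen, LinearMap.add_apply,
        Module.End.mul_apply, EndZ.coeff_leftMul, LinearMap.zero_apply]
      rw [← mul_assoc, ← mul_assoc, ← add_mul, OPol.x_anticomm h, zero_mul]
    | cross_cross i j h =>
      simp only [map_add, map_mul, map_zero, FreeAlgebra.lift_ι_apply, actGen, LinearMap.add_apply,
        Module.End.mul_apply, EndZ.coeff_crossing, LinearMap.zero_apply]
      exact OPol.divDiff_comm h _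
    | cross_sq i =>
      simp only [map_mul, map_zero, FreeAlgebra.lift_ι_apply, actGen,
        Module.End.mul_apply, EndZ.coeff_crossing, LinearMap.zero_apply]
      exact OPol.divDiff_divDiff _ _
    | braid i j h =>
      simp only [map_mul, FreeAlgebra.lift_ι_apply, actGen,
        Module.End.mul_apply, EndZ.coeff_crossing]
      exact OPol.divDiff_braid h _
    | cross_dot i j h₁ h₂ =>
      simp only [map_add, map_mul, map_zero, FreeAlgebra.lift_ι_apply, actGen, LinearMap.add_apply,
        Module.End.mul_apply, EndZ.coeff_crossing, EndZ.coeff_leftMul, LinearMap.zero_apply]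
      rw [OPol.divDiff_x_mul, Equiv.swap_apply_of_ne_of_ne h₁ h₂, if_neg (by tauto)]
      abel
    | slide_left i =>
      simp only [map_add, map_mul, map_one, FreeAlgebra.lift_ι_apply, actGen, LinearMap.add_apply,
        Module.End.mul_apply, EndZ.coeff_crossing, EndZ.coeff_leftMul, Module.End.one_apply]
      rw [OPol.divDiff_x_mul, Equiv.swap_apply_right, if_pos (Or.inr rfl)]
      abel
    | slide_right i =>
      simp only [map_add, map_mul, map_one, FreeAlgebra.lift_ι_apply, actGen, LinearMap.add_apply,
        Module.End.mul_apply, EndZ.coeff_crossing, EndZ.coeff_leftMul, Module.End.one_apply]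
      rw [OPol.divDiff_x_mul, Equiv.swap_apply_left, if_pos (Or.inl rfl)]
      abel)

theorem act_gen (g : ONHGen n) : act k n (gen k n g) = actGen g := lift_gen ..

variable (k n) in
/-- The embedding of the skew polynomials into the odd nilHecke algebra. -/
def ofOPol : OPol k n →ₐ[k] ONH k n := OPol.lift (x k n) fun _ _ => dot_dot

theorem act_ofOPol (f : OPol k n) : act k n (ofOPol k n f) = EndZ.leftMul f := by
  apply EndZ.ext_coeff
  intro m
  rw [EndZ.coeff_leftMul]
  induction f using OPol.gen_induction with
  | one => rw [map_one, map_one, Module.End.one_apply, one_mul]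
  | add a b ha hb => rw [map_add, map_add, LinearMap.add_apply, map_add, ha, hb, add_mul]
  | smul r a ha =>
    rw [map_smul, map_smul, LinearMap.smul_apply, ZBim.coeff_k_smul, ha, smul_mul_assoc]
  | x_mul i a ha =>
    rw [map_mul, map_mul, Module.End.mul_apply, ofOPol, OPol.lift_x, x, act_gen, actGen,
      EndZ.coeff_leftMul, mul_assoc, ← ha]
    rfl

/-- The polynomial `c · f`. -/
def apply (c : ONH k n) (f : OPol k n) : OPol k n :=
  ZBim.coeff k n (act k n c (f • ZBim.z k n))

theorem mul_apply (c c' : ONH k n) (f : OPol k n) : apply (c * c') f = apply c (apply c' f) := by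
  have h : ∀ m : ZBim k n, ZBim.coeff k n m • ZBim.z k n = m := fun m =>
    (ZBim.coeff k n).injective (ZBim.coeff_smul_z _)
  rw [apply, apply, apply, h, map_mul, Module.End.mul_apply]

theorem apply_gen_dot (i : Fin n) (f : OPol k n) :
    apply (gen k n (ONHGen.dot i)) f = OPol.x k n i * f := by
  rw [apply, act_gen, actGen, EndZ.coeff_leftMul, ZBim.coeff_smul_z]

theorem apply_gen_cross (i : Fin (n - 1)) (f : OPol k n) :
    apply (gen k n (ONHGen.cross i)) f = OPol.divDiff k n i f := by
  rw [apply, act_gen, actGen, EndZ.coeff_crossing, ZBim.coeff_smul_z]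

theorem apply_ofOPol (g f : OPol k n) : apply (ofOPol k n g) f = g * f := by
  rw [apply, act_ofOPol, EndZ.coeff_leftMul, ZBim.coeff_smul_z]

theorem one_apply (f : OPol k n) : apply (1 : ONH k n) f = f := by
  rw [apply, map_one, Module.End.one_apply, ZBim.coeff_smul_z]

theorem add_apply (c c' : ONH k n) (f : OPol k n) : apply (c + c') f = apply c f + apply c' f := by
  rw [apply, map_add, LinearMap.add_apply, map_add]; rfl

theorem smul_apply (r : k) (c : ONH k n) (f : OPol k n) : apply (r • c) f = r • apply c f := by
  rw [apply, map_smul (act k n), LinearMap.smul_apply, ZBim.coeff_k_smul]; rfl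

theorem apply_add (c : ONH k n) (f g : OPol k n) : apply c (f + g) = apply c f + apply c g := by
  rw [apply, add_smul, map_add, map_add]; rfl

theorem del_mul_longest (i : Fin (n - 1)) : del k n i * longest k n n = 0 := by
  have h := cross_mul_longest (k := k) (n := n) (m := n) (i := i) (by omega)
  rwa [cross, dif_pos i.2] at h

/-- Crossings slide past polynomials in front of the longest crossing. -/
theorem del_mul_ofOPol_mul_longest (i : Fin (n - 1)) (f : OPol k n) :
    del k n i * ofOPol k n f * longest k n n = ofOPol k n (OPol.divDiff k n i f) * longest k n n := by
  induction f using OPol.gen_induction with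
  | one => rw [map_one, mul_one, OPol.divDiff_one, map_zero, zero_mul, del_mul_longest]
  | add a b ha hb => simp only [map_add, mul_add, add_mul, ha, hb]
  | smul r a ha => simp only [map_smul, mul_smul_comm, smul_mul_assoc, ha]
  | x_mul j a ha =>
    have hx : del k n i * x k n j =
        (if j = lo i ∨ j = hi i then 1 else 0) - x k n (Equiv.swap (lo i) (hi i) j) * del k n i := by
      rw [eq_sub_iff_add_eq]
      by_cases h₁ : j = lo i
      · rw [h₁, Equiv.swap_apply_left, if_pos (Or.inl rfl), slide_right]
      · by_cases h₂ : j = hi i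
        · rw [h₂, Equiv.swap_apply_right, if_pos (Or.inr rfl), add_comm, slide_left]
        · rw [if_neg (by tauto), Equiv.swap_apply_of_ne_of_ne h₁ h₂, cross_dot h₁ h₂]
    have e : ∀ l, ofOPol k n (OPol.x k n l) = x k n l := fun l => OPol.lift_x ..
    rw [map_mul, e, ← mul_assoc, hx, OPol.divDiff_x_mul, map_sub, map_mul, e, sub_mul, sub_mul,
      sub_mul, mul_assoc (x k n _), mul_assoc (x k n _), ha, mul_assoc (x k n _)]
    congr 1
    split_ifs
    · rw [one_mul]
    · rw [zero_mul, map_zero]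

theorem mul_ofOPol_mul_longest (c : ONH k n) (f : OPol k n) :
    c * ofOPol k n f * longest k n n = ofOPol k n (apply c f) * longest k n n := by
  induction c using gen_induction with
  | one => rw [one_apply, one_mul]
  | add a b ha hb => rw [add_mul, add_mul, ha, hb, add_apply, map_add, add_mul]
  | smul r a ha => rw [smul_mul_assoc, smul_mul_assoc, ha, smul_apply, map_smul, smul_mul_assoc]
  | gen_mul g a ha =>
    rw [mul_assoc, mul_assoc, ← mul_assoc a, ha, mul_apply, ← mul_assoc]
    cases g with
    | dot i =>
      rw [apply_gen_dot, map_mul]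
      congr 2
      exact (OPol.lift_x (x k n) (fun _ _ => dot_dot) i).symm
    | cross i => rw [apply_gen_cross]; exact del_mul_ofOPol_mul_longest i _

/-- In front of the longest crossing, `c` can be replaced by the polynomial it produces from `1`, so
the action already determines the products that matter. -/
theorem mul_longest (c : ONH k n) :
    c * longest k n n = ofOPol k n (apply c 1) * longest k n n := by
  rw [← mul_ofOPol_mul_longest, map_one, mul_one]

/-- If `c` acts as zero, so does `c a`, and `mul_longest` kills `c a D b` for all `a`, `b`, with `D`
the longest crossing. These products add up to `c * 1`. -/
theorem act_injective : Function.Injective (act k n) := by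
  rw [injective_iff_map_eq_zero]
  intro c hc
  have h : c * 1 = 0 := by
    refine ideal_induction (P := fun e => c * e = 0) ?_ ?_
    · intro a b
      have h₀ : apply (c * a) 1 = 0 := by
        rw [apply, map_mul, hc, zero_mul, LinearMap.zero_apply, map_zero]
      rw [← mul_assoc, ← mul_assoc, mul_longest (c * a), h₀, map_zero, zero_mul, zero_mul]
    · intro a b ha hb
      rw [mul_add, ha, hb, add_zero]
  rwa [mul_one] at h

theorem cross_apply_mem (i d : ℕ) {a : OPol k n} (ha : a ∈ OPol.degreeLEOne k n ^ (d + 1)) :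
    apply (cross k n i) a ∈ OPol.degreeLEOne k n ^ d := by
  unfold cross
  split_ifs
  · rw [del, apply_gen_cross]
    exact OPol.divDiff_degreeLEOne_pow _ d ha
  · rw [apply, map_zero, LinearMap.zero_apply, map_zero]
    exact zero_mem _

theorem chain_apply_mem (j t d : ℕ) {a : OPol k n} (ha : a ∈ OPol.degreeLEOne k n ^ (d + t)) :
    apply (chain k n j t) a ∈ OPol.degreeLEOne k n ^ d := by
  induction t generalizing j a with
  | zero => rwa [chain_zero, one_apply]
  | succ t ih =>
    rw [chain_succ, mul_apply]
    exact ih _ (cross_apply_mem _ _ ha)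

/-- The longest crossing on `m` strands has `0 + 1 + ⋯ + (m - 1)` factors, each lowering the degree
by one. -/
theorem longest_apply_mem (m d : ℕ) {a : OPol k n}
    (ha : a ∈ OPol.degreeLEOne k n ^ (d + ∑ i ∈ Finset.range m, i)) :
    apply (longest k n m) a ∈ OPol.degreeLEOne k n ^ d := by
  induction m generalizing a with
  | zero => rwa [longest_zero, one_apply]
  | succ m ih =>
    rw [longest_succ, mul_apply]
    rw [Finset.sum_range_succ, ← add_assoc] at ha
    exact ih (chain_apply_mem _ _ _ ha)

/-- The longest crossing maps skew polynomials to (twisted) odd symmetric polynomials. -/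
theorem longest_apply_mem_twistedOSym (f : OPol k n) :
    apply (longest k n n) f ∈ OPol.twistedOSym k n := by
  have hf : f ∈ OPol.degreeLEOne k n ^ (∑ i ∈ Finset.range n, i) * OPol.twistedOSym k n := by
    rw [OPol.degreeLEOne_pow_mul_twistedOSym]; trivial
  induction hf using Submodule.mul_induction_on' with
  | mem_mul_mem a ha s hs =>
    obtain ⟨s, hs', rfl⟩ := hs
    have h : apply (longest k n n) (a * OPol.thetaW0 k n s) =
        apply (longest k n n) a * OPol.thetaW0 k n s :=
      EndZ.coeff_map_mul (act k n (longest k n n)) a ⟨s, hs'⟩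
    -- The degree bound on `a` equals the number of crossings, so `a` is sent to a constant.
    have h₀ := longest_apply_mem n 0 (by rwa [zero_add])
    rw [pow_zero] at h₀
    obtain ⟨r, hr⟩ := Submodule.mem_one.1 h₀
    rw [AlgHom.toLinearMap_apply, h, ← hr, ← Algebra.smul_def]
    exact Submodule.smul_mem _ _ ⟨s, hs', rfl⟩
  | add a _ b _ ha hb => rw [apply_add]; exact add_mem ha hb

/-- It suffices that `F` composed with the action of `a D b` lies in the image, for `D` the longest
crossing, since such products add up to `1`. -/
theorem act_surjective : Function.Surjective (act k n) := by
  intro F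
  have h : F * act k n 1 ∈ (act k n).range := by
    refine ideal_induction (P := fun e => F * act k n e ∈ (act k n).range) ?_ ?_
    · intro a b
      -- Since `a D = (a · 1) D` and `D b f` is a twisted symmetric `s`, right linearity gives `F
      -- ((a · 1) s z) = F ((a · 1) z) s`. So `a` is replaced by the polynomial coefficient of `F
      -- ((a · 1) z)`.
      refine ⟨ofOPol k n (ZBim.coeff k n (F (apply a 1 • ZBim.z k n))) * longest k n n * b, ?_⟩
      apply EndZ.ext_coeff
      intro m
      obtain ⟨f, rfl⟩ : ∃ f : OPol k n, f • ZBim.z k n = m :=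
        ⟨ZBim.coeff k n m, (ZBim.coeff k n).injective (ZBim.coeff_smul_z _)⟩
      change apply (ofOPol k n _ * longest k n n * b) f = _
      obtain ⟨s, hs, e⟩ := longest_apply_mem_twistedOSym (apply b f)
      rw [AlgHom.toLinearMap_apply] at e
      have h₁ : act k n (a * longest k n n * b) (f • ZBim.z k n) =
          (apply a 1 * OPol.thetaW0 k n s) • ZBim.z k n := by
        apply (ZBim.coeff k n).injective
        change apply (a * longest k n n * b) f = _
        rw [ZBim.coeff_smul_z, mul_longest, mul_apply, mul_apply, apply_ofOPol, e]
      rw [mul_apply, mul_apply, apply_ofOPol, Module.End.mul_apply, h₁, ← e]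
      exact (EndZ.coeff_map_mul F (apply a 1) ⟨s, hs⟩).symm
    · intro a b ha hb
      rw [map_add, mul_add]
      exact add_mem ha hb
  rwa [map_one, mul_one] at h

theorem act_mem_part {p : ZMod 2} {a : ONH k n} (ha : a ∈ part k n p) :
    act k n a ∈ EndZ.part k n p := by
  refine wordPart_induction (P := fun p a => act k n a ∈ EndZ.part k n p) ?_ ?_ ?_ ?_ ?_ ha
  · rw [map_one]; exact EndZ.one_mem_part
  · intro p; rw [map_zero]; exact zero_mem _
  · intro p a b ha hb; rw [map_add]; exact add_mem ha hb
  · intro p r a ha; rw [map_smul]; exact Submodule.smul_mem _ _ ha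
  · intro p g a _ ha
    rw [map_mul, act_gen, add_comm]
    refine EndZ.mul_mem_part ?_ ha
    cases g with
    | dot i => exact EndZ.leftMul_mem_part (OPol.x_mem_part i)
    | cross i => exact EndZ.crossing_mem_part i

/-- The component of `a` of the wrong parity acts with both parities, hence as zero, and the action
is faithful. -/
theorem mem_part_of_act_mem_part {p : ZMod 2} {a : ONH k n} (ha : act k n a ∈ EndZ.part k n p) :
    a ∈ part k n p := by
  obtain ⟨b, hb, c, hc, rfl⟩ : ∃ b ∈ part k n p, ∃ c ∈ part k n (p + 1), b + c = a := by
    have h : a ∈ part k n 0 ⊔ part k n 1 := by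
      rw [← iSup_zmod_two, iSup_part]; trivial
    rcases zmod_two_eq_zero_or_one p with rfl | rfl
    · rw [zero_add]
      exact Submodule.mem_sup.1 h
    · rw [CharTwo.add_self_eq_zero]
      rw [sup_comm] at h
      exact Submodule.mem_sup.1 h
  rw [map_add] at ha
  have hc' : act k n c ∈ EndZ.part k n p := by
    have := sub_mem ha (act_mem_part hb)
    rwa [add_sub_cancel_left] at this
  have h := act_injective ((EndZ.eq_zero_of_mem_part hc' (act_mem_part hc)).trans (map_zero _).symm)
  rwa [h, add_zero]

/-- Both sides obey the same Leibniz rule for an odd generator on the left, so only the generators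
need a computation: `EndZ.d_leftMul` and `EndZ.d_crossing`. -/
theorem act_d (a : ONH k n) : act k n (d k n a) = EndZ.d k n (act k n a) := by
  have hone : EndZ.d k n 1 = 0 := by
    have h := EndZ.d_mul_of_mem (k := k) (n := n) EndZ.one_mem_part 1
    rw [mul_one, mul_one, one_mul, uzpow_zero, one_smul] at h
    exact left_eq_add.1 h
  induction a using gen_induction with
  | one => rw [d_one, map_zero, map_one, hone]
  | add a b ha hb => simp only [map_add, ha, hb]
  | smul r a ha => simp only [map_smul, ha]
  | gen_mul g a ha =>
    have hg : actGen (k := k) g ∈ EndZ.part k n 1 := by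
      rw [← act_gen]
      exact act_mem_part (gen_mem_wordPart g)
    have hd : act k n (d k n (gen k n g)) = EndZ.d k n (actGen g) := by
      rw [d_gen]
      cases g with
      | dot i =>
        rw [actGen, EndZ.d_leftMul _ (OPol.x_mem_part i), OPol.d_x, ← act_ofOPol, map_pow, ofOPol,
          OPol.lift_x, dGen]
      | cross i => rw [actGen, EndZ.d_crossing, dGen, map_one]
    rw [d_gen_mul, map_sub, map_mul, map_mul, map_mul, hd, ha, act_gen, EndZ.d_mul_of_mem hg,
      uzpow_one, Units.neg_smul, one_smul, sub_eq_add_neg]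

variable (k n) in
/-- The odd nilHecke algebra is the endomorphism algebra of `Z_n`. -/
def actEquiv : ONH k n ≃ₐ[k] EndZ k n :=
  AlgEquiv.ofBijective (act k n) ⟨act_injective, act_surjective⟩

end ONH

/-- That every endomorphism is a sum of homogeneous ones is transported from `ONH_n` through the
surjective, parity-preserving action. -/
theorem EndZ.isDGAlgebra (k : Type*) [CommRing k] (n : ℕ) :
    IsDGAlgebra (EndZ.part k n) (EndZ.d k n) where
  graded :=
    { one_mem := EndZ.one_mem_part
      mul_mem := fun _ _ _ _ => EndZ.mul_mem_part }
  internal := by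
    refine isInternal_of_disjoint (fun F h₀ h₁ => EndZ.eq_zero_of_mem_part h₀ h₁) ?_
    rw [eq_top_iff]
    intro F _
    obtain ⟨a, rfl⟩ := ONH.act_surjective F
    have ha : a ∈ ⨆ p, ONH.part k n p := by rw [ONH.iSup_part]; trivial
    induction ha using Submodule.iSup_induction' with
    | mem p a ha => exact Submodule.mem_iSup_of_mem p (ONH.act_mem_part ha)
    | zero => rw [map_zero]; exact zero_mem _
    | add a b _ _ ha hb => rw [map_add]; exact add_mem (ha trivial) (hb trivial)
  odd _ _ := EndZ.d_mem_part
  sq_zero := EndZ.d_d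
  leibniz _ _ hF G := EndZ.d_mul_of_mem hF G

end OddNil

end
open OddNil in
theorem mainTheorem6 (k : Type*) [CommRing k] (n : ℕ) :
    IsDGBimodule (OPol.part k n) (OPol.d k n) (OSym.part k n) (OSym.d k n)
      (ZBim.part k n) (ZBim.d k n) ∧
    IsDGAlgebra (ONH.part k n) (ONH.d k n) ∧
    IsDGAlgebra (EndZ.part k n) (EndZ.d k n) ∧
    (∃ Φ : ONH k n ≃ₐ[k] EndZ k n,
      IsDGAlgEquiv (ONH.part k n) (ONH.d k n) (EndZ.part k n) (EndZ.d k n) Φ ∧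
      (∀ i f, Φ (ONH.x k n i) (f • ZBim.z k n) = (OPol.x k n i * f) • ZBim.z k n) ∧
      (∀ i f, Φ (ONH.del k n i) (f • ZBim.z k n) = OPol.divDiff k n i f • ZBim.z k n)) ∧
    (∀ i, ONH.d k n (ONH.x k n i) = ONH.x k n i ^ 2) ∧
    (∀ i, ONH.d k n (ONH.del k n i) = 1) := by
  refine ⟨ZBim.isDGBimodule k n, ONH.isDGAlgebra k n, EndZ.isDGAlgebra k n,
    ⟨ONH.actEquiv k n, ⟨fun p a => ⟨ONH.mem_part_of_act_mem_part, ONH.act_mem_part⟩, ONH.act_d⟩,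
      fun i f => ?_, fun i f => ?_⟩, ONH.d_x, ONH.d_del⟩
  · apply (ZBim.coeff k n).injective
    rw [ZBim.coeff_smul_z]
    exact ONH.apply_gen_dot i f
  · apply (ZBim.coeff k n).injective
    rw [ZBim.coeff_smul_z]
    exact ONH.apply_gen_cross i f
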